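/- Let $M$ be a connected smooth manifold (Hausdorff, without boundary) of dimension $n=p+q$ and let $g$ be a smooth pseudo-Riemannian metric of signature $(p,q)$ on $M$. Suppose that the Riemann curvature tensor of $g$ vanishes at some point $x\in M$. Then the Lie algebra of Killing fields of $g$, i.e. of the smooth vector fields $K$ defined on all of $M$ with $K_{a;b}+K_{b;a}=0$ (the semicolon denoting covariant differentiation with respect to the Levi-Civita connection of $g$), with the Lie bracket of vector fields, is isomorphic to a Lie subalgebra of the Lie algebra $\mathbb{R}^n\rtimes\mathfrak{so}(p,q)$ of the semidirect product Lie group $\mathbb{R}^n\rtimes SO(p,q)$, where $SO(p,q)$ acts on $\mathbb{R}^n$ in the standard way. -/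

import Mathlib

open Bundle VectorField
open scoped Manifold ContDiff

noncomputable section

section Metric

variable {E : Type*} [NormedAddCommGroup E] [NormedSpace ℝ E]
  {H : Type*} [TopologicalSpace H] (I : ModelWithCorners ℝ E H)
  (M : Type*) [TopologicalSpace M] [ChartedSpace H M] [IsManifold I ∞ M]

/-- A smooth pseudo-Riemannian metric of signature `(p, q)` on `M`: a smooth field of symmetric
bilinear forms on the tangent spaces, each of which has an orthonormal basis consisting of
`p` vectors of square `1` and `q` vectors of square `-1`. -/
structure PseudoRiemannianMetric (p q : ℕ) where
  /-- The bilinear form on each tangent space. -/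
  form (x : M) : TangentSpace I x →L[ℝ] TangentSpace I x →L[ℝ] ℝ
  contMDiff : ContMDiff I (I.prod 𝓘(ℝ, E →L[ℝ] E →L[ℝ] ℝ)) ∞
    (fun x ↦ TotalSpace.mk' (E →L[ℝ] E →L[ℝ] ℝ) x (form x))
  symm (x : M) (u v : TangentSpace I x) : form x u v = form x v u
  signature (x : M) : ∃ b : Module.Basis (Fin p ⊕ Fin q) ℝ (TangentSpace I x),
    ∀ i j, form x (b i) (b j) = LieAlgebra.Orthogonal.indefiniteDiagonal (Fin p) (Fin q) ℝ i j

end Metric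

namespace PseudoRiemannianMetric

variable {E : Type*} [NormedAddCommGroup E] [NormedSpace ℝ E]
  {H : Type*} [TopologicalSpace H] {I : ModelWithCorners ℝ E H}
  {M : Type*} [TopologicalSpace M] [ChartedSpace H M] [IsManifold I ∞ M]
  {p q : ℕ} (g : PseudoRiemannianMetric I M p q)

/-- The function `g(X, Y)` on `M`, for vector fields `X` and `Y`. -/
def pair (X Y : Π x : M, TangentSpace I x) (x : M) : ℝ := g.form x (X x) (Y x)

theorem mdifferentiableAt_pair {X Y : Π x : M, TangentSpace I x} {x : M}
    (hX : MDiffAt (T% X) x) (hY : MDiffAt (T% Y) x) : MDiffAt (g.pair X Y) x := by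
  have h : MDifferentiableAt I (I.prod 𝓘(ℝ))
      (fun m ↦ TotalSpace.mk' ℝ (E := Bundle.Trivial M ℝ) m (g.form m (X m) (Y m))) x := by
    apply MDifferentiableAt.clm_bundle_apply₂ (F₁ := E) (F₂ := E)
    · exact (g.contMDiff x).mdifferentiableAt (by simp)
    · exact hX
    · exact hY
  simp only [mdifferentiableAt_totalSpace] at h
  exact h.2

theorem contMDiffAt_pair {X Y : Π x : M, TangentSpace I x} {x : M}
    (hX : CMDiffAt ∞ (T% X) x) (hY : CMDiffAt ∞ (T% Y) x) : CMDiffAt ∞ (g.pair X Y) x := by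
  have h : ContMDiffAt I (I.prod 𝓘(ℝ)) ∞
      (fun m ↦ TotalSpace.mk' ℝ (E := Bundle.Trivial M ℝ) m (g.form m (X m) (Y m))) x := by
    apply ContMDiffAt.clm_bundle_apply₂ (F₁ := E) (F₂ := E)
    · exact g.contMDiff x
    · exact hX
    · exact hY
  simp only [contMDiffAt_totalSpace] at h
  exact h.2

theorem eq_of_form_eq {x : M} {u v : TangentSpace I x}
    (h : ∀ w, g.form x u w = g.form x v w) : u = v := by
  obtain ⟨b, hb⟩ := g.signature x
  apply b.ext_elem
  intro i
  have key : ∀ w : TangentSpace I x, g.form x w (b i) =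
      b.repr w i * LieAlgebra.Orthogonal.indefiniteDiagonal (Fin p) (Fin q) ℝ i i := by
    intro w
    conv_lhs => rw [← b.sum_repr w]
    simp only [map_sum, map_smul, sum_apply, smul_apply, hb, smul_eq_mul]
    rw [Finset.sum_eq_single i]
    · intro j _ hj
      simp [LieAlgebra.Orthogonal.indefiniteDiagonal, Matrix.diagonal_apply_ne _ hj]
    · simp
  have h1 := h (b i)
  rw [key, key] at h1
  refine mul_right_cancel₀ ?_ h1
  rcases i with i | i <;> simp [LieAlgebra.Orthogonal.indefiniteDiagonal]

theorem symm_pair (X Y : Π x : M, TangentSpace I x) : g.pair X Y = g.pair Y X :=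
  funext fun x ↦ g.symm x _ _

/-- The right-hand side of Koszul's formula: half of
`X g(Y, Z) + Y g(X, Z) - Z g(X, Y) + g([X, Y], Z) - g([X, Z], Y) - g([Y, Z], X)` at `x`. -/
def koszul (X Y Z : Π x : M, TangentSpace I x) (x : M) : ℝ :=
  2⁻¹ * (d% (g.pair Y Z) x (X x) + d% (g.pair X Z) x (Y x) - d% (g.pair X Y) x (Z x)
    + g.form x (mlieBracket I X Y x) (Z x) - g.form x (mlieBracket I X Z x) (Y x)
    - g.form x (mlieBracket I Y Z x) (X x))

theorem pair_add_left (X X' Y : Π x : M, TangentSpace I x) :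
    g.pair (X + X') Y = fun x ↦ g.pair X Y x + g.pair X' Y x := by
  funext x; simp [pair]

theorem pair_add_right (X Y Y' : Π x : M, TangentSpace I x) :
    g.pair X (Y + Y') = fun x ↦ g.pair X Y x + g.pair X Y' x := by
  funext x; simp [pair]

theorem pair_smul_left (f : M → ℝ) (X Y : Π x : M, TangentSpace I x) :
    g.pair (f • X) Y = fun x ↦ f x * g.pair X Y x := by
  funext x; simp [pair]

theorem pair_smul_right (f : M → ℝ) (X Y : Π x : M, TangentSpace I x) :
    g.pair X (f • Y) = fun x ↦ f x * g.pair X Y x := by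
  funext x; simp [pair]

variable [FiniteDimensional ℝ E]

theorem tensorialAt_koszul_left {Y Z : Π x : M, TangentSpace I x} {x : M}
    (hY : MDiffAt (T% Y) x) (hZ : MDiffAt (T% Z) x) :
    TensorialAt I E (fun X ↦ g.koszul X Y Z x) x where
  smul {f X} hf hX := by
    have := FiniteDimensional.complete ℝ E
    simp only [koszul, pair_smul_left, mlieBracket_smul_left hf hX,
      mvfderiv_fun_mul hf (g.mdifferentiableAt_pair hX hZ),
      mvfderiv_fun_mul hf (g.mdifferentiableAt_pair hX hY)]
    simp [pair, g.symm x (X x)]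
    ring
  add {X X'} hX hX' := by
    have := FiniteDimensional.complete ℝ E
    simp only [koszul, pair_add_left, mlieBracket_add_left hX hX',
      mvfderiv_fun_add (g.mdifferentiableAt_pair hX hZ) (g.mdifferentiableAt_pair hX' hZ),
      mvfderiv_fun_add (g.mdifferentiableAt_pair hX hY) (g.mdifferentiableAt_pair hX' hY)]
    simp
    ring

theorem tensorialAt_koszul_right {X Y : Π x : M, TangentSpace I x} {x : M}
    (hX : MDiffAt (T% X) x) (hY : MDiffAt (T% Y) x) :
    TensorialAt I E (fun Z ↦ g.koszul X Y Z x) x where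
  smul {f Z} hf hZ := by
    have := FiniteDimensional.complete ℝ E
    simp only [koszul, pair_smul_right, mlieBracket_smul_right hf hZ,
      mvfderiv_fun_mul hf (g.mdifferentiableAt_pair hX hZ),
      mvfderiv_fun_mul hf (g.mdifferentiableAt_pair hY hZ)]
    simp [pair, g.symm x (Z x)]
    ring
  add {Z Z'} hZ hZ' := by
    have := FiniteDimensional.complete ℝ E
    simp only [koszul, pair_add_right, mlieBracket_add_right hZ hZ',
      mvfderiv_fun_add (g.mdifferentiableAt_pair hX hZ) (g.mdifferentiableAt_pair hX hZ'),
      mvfderiv_fun_add (g.mdifferentiableAt_pair hY hZ) (g.mdifferentiableAt_pair hY hZ')]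
    simp
    ring

/-- The musical isomorphism `u ↦ g(u, ·)` from the tangent space to the cotangent space. -/
def flat (x : M) : TangentSpace I x ≃ₗ[ℝ] (TangentSpace I x →L[ℝ] ℝ) :=
  have : FiniteDimensional ℝ (TangentSpace I x) := inferInstanceAs (FiniteDimensional ℝ E)
  have : T2Space (TangentSpace I x) := inferInstanceAs (T2Space E)
  LinearMap.linearEquivOfInjective (g.form x : TangentSpace I x →ₗ[ℝ] TangentSpace I x →L[ℝ] ℝ)
    (fun _ _ h ↦ g.eq_of_form_eq fun w ↦ congrArg (fun φ ↦ φ w) h)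
    (Subspace.dual_finrank_eq.symm.trans
      (LinearMap.toContinuousLinearMap :
        (TangentSpace I x →ₗ[ℝ] ℝ) ≃ₗ[ℝ] (TangentSpace I x →L[ℝ] ℝ)).finrank_eq)

theorem form_flat_symm (x : M) (φ : TangentSpace I x →L[ℝ] ℝ) (w : TangentSpace I x) :
    g.form x ((g.flat x).symm φ) w = φ w :=
  congrArg (fun ψ : TangentSpace I x →L[ℝ] ℝ ↦ ψ w) ((g.flat x).apply_symm_apply φ)

open Classical in
/-- The Levi-Civita connection of `g` as a bare function, determined by Koszul's formula:
`leviCivitaFun Y x u` is `∇_u Y`, with the value `0` where `Y` is not differentiable. -/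
def leviCivitaFun (Y : Π x : M, TangentSpace I x) (x : M) :
    TangentSpace I x →L[ℝ] TangentSpace I x :=
  have : FiniteDimensional ℝ (TangentSpace I x) := inferInstanceAs (FiniteDimensional ℝ E)
  have : T2Space (TangentSpace I x) := inferInstanceAs (T2Space E)
  if hY : MDiffAt (T% Y) x then
    LinearMap.toContinuousLinearMap ((g.flat x).symm.toLinearMap ∘ₗ
      (TensorialAt.mkHom₂ (F := E) (F' := E) (fun X Z ↦ g.koszul X Y Z x) x
        (fun _ hZ ↦ g.tensorialAt_koszul_left hY hZ)
        (fun _ hX ↦ g.tensorialAt_koszul_right hX hY)).toLinearMap)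
  else 0

theorem form_leviCivitaFun {X Y Z : Π x : M, TangentSpace I x} {x : M}
    (hX : MDiffAt (T% X) x) (hY : MDiffAt (T% Y) x) (hZ : MDiffAt (T% Z) x) :
    g.form x (g.leviCivitaFun Y x (X x)) (Z x) = g.koszul X Y Z x := by
  rw [leviCivitaFun, dif_pos hY]
  refine (g.form_flat_symm x _ _).trans ?_
  exact TensorialAt.mkHom₂_apply _ _ hX hZ

/-- To compare two endomorphisms of a tangent space it suffices to pair them with
vector fields. -/
theorem endo_ext {x : M} {A B : TangentSpace I x →L[ℝ] TangentSpace I x}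
    (h : ∀ X Z : Π x : M, TangentSpace I x, MDiffAt (T% X) x → MDiffAt (T% Z) x →
      g.form x (A (X x)) (Z x) = g.form x (B (X x)) (Z x)) : A = B := by
  ext u
  apply g.eq_of_form_eq
  intro w
  simpa using h (FiberBundle.extend E u) (FiberBundle.extend E w)
    (FiberBundle.mdifferentiableAt_extend ..) (FiberBundle.mdifferentiableAt_extend ..)

/-- The Levi-Civita connection of `g`. -/
def leviCivita : CovariantDerivative I E (TangentSpace I : M → Type _) where
  toFun := g.leviCivitaFun
  isCovariantDerivativeOnUniv :=
    { add := by
        intro Y Y' x hY hY' _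
        have := FiniteDimensional.complete ℝ E
        apply g.endo_ext
        intro X Z hX hZ
        have hs : MDiffAt (T% (Y + Y')) x := mdifferentiableAt_add_section hY hY'
        rw [g.form_leviCivitaFun hX hs hZ, add_apply, map_add, add_apply,
          g.form_leviCivitaFun hX hY hZ, g.form_leviCivitaFun hX hY' hZ]
        simp only [koszul, pair_add_left, pair_add_right, mlieBracket_add_left hY hY',
          mlieBracket_add_right hY hY',
          mvfderiv_fun_add (g.mdifferentiableAt_pair hY hZ) (g.mdifferentiableAt_pair hY' hZ),
          mvfderiv_fun_add (g.mdifferentiableAt_pair hX hY) (g.mdifferentiableAt_pair hX hY')]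
        simp
        ring
      leibniz := by
        intro Y f x hY hf _
        have := FiniteDimensional.complete ℝ E
        apply g.endo_ext
        intro X Z hX hZ
        have hs : MDiffAt (T% (f • Y)) x := hf.smul_section hY
        rw [g.form_leviCivitaFun hX hs hZ, add_apply, map_add, add_apply, smul_apply, map_smul,
          smul_apply, g.form_leviCivitaFun hX hY hZ]
        simp only [koszul, pair_smul_left, pair_smul_right, mlieBracket_smul_left hf hY,
          mlieBracket_smul_right hf hY,
          mvfderiv_fun_mul hf (g.mdifferentiableAt_pair hY hZ),
          mvfderiv_fun_mul hf (g.mdifferentiableAt_pair hX hY)]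
        simp [pair, g.symm x (Y x)]
        ring }

theorem form_leviCivita {X Y Z : Π x : M, TangentSpace I x} {x : M}
    (hX : MDiffAt (T% X) x) (hY : MDiffAt (T% Y) x) (hZ : MDiffAt (T% Z) x) :
    g.form x (g.leviCivita Y x (X x)) (Z x) = g.koszul X Y Z x :=
  g.form_leviCivitaFun hX hY hZ

/-- The Levi-Civita connection is torsion-free. -/
theorem leviCivita_torsion {X Y : Π x : M, TangentSpace I x} {x : M}
    (hX : MDiffAt (T% X) x) (hY : MDiffAt (T% Y) x) :
    g.leviCivita Y x (X x) - g.leviCivita X x (Y x) = mlieBracket I X Y x := by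
  apply g.eq_of_form_eq
  intro w
  have hZ := FiberBundle.mdifferentiableAt_extend I E w
  have hw : FiberBundle.extend E w x = w := by simp
  have h1 := g.form_leviCivita hX hY hZ
  have h2 := g.form_leviCivita hY hX hZ
  rw [hw] at h1 h2
  rw [map_sub, sub_apply, h1, h2]
  simp only [koszul, hw, g.symm_pair Y X, mlieBracket_swap_apply (V := Y) (W := X), map_neg,
    neg_apply]
  ring

/-- The Levi-Civita connection is compatible with the metric. -/
theorem leviCivita_metric {X Y Z : Π x : M, TangentSpace I x} {x : M}
    (hX : MDiffAt (T% X) x) (hY : MDiffAt (T% Y) x) (hZ : MDiffAt (T% Z) x) :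
    d% (g.pair Y Z) x (X x) =
      g.form x (g.leviCivita Y x (X x)) (Z x) + g.form x (Y x) (g.leviCivita Z x (X x)) := by
  rw [g.symm x (Y x), g.form_leviCivita hX hY hZ, g.form_leviCivita hX hZ hY]
  simp only [koszul, g.symm_pair Z Y, mlieBracket_swap_apply (V := Z) (W := Y), map_neg,
    neg_apply]
  ring

/-- The curvature operator
`R(X, Y) Z = ∇_X ∇_Y Z - ∇_Y ∇_X Z - ∇_{[X, Y]} Z` of the Levi-Civita connection. -/
def curvature (X Y Z : Π x : M, TangentSpace I x) (x : M) : TangentSpace I x :=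
  g.leviCivita (fun y ↦ g.leviCivita Z y (Y y)) x (X x)
    - g.leviCivita (fun y ↦ g.leviCivita Z y (X y)) x (Y x)
    - g.leviCivita Z x (mlieBracket I X Y x)

/-- The Riemann curvature tensor vanishes at the point `x`: for all vector fields `X`, `Y`, `Z`
that are smooth at `x`, the vector `R(X, Y) Z` is zero at `x`. -/
def CurvatureVanishesAt (x : M) : Prop :=
  ∀ X Y Z : Π x : M, TangentSpace I x,
    CMDiffAt ∞ (T% X) x → CMDiffAt ∞ (T% Y) x → CMDiffAt ∞ (T% Z) x → g.curvature X Y Z x = 0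

/-- Killing's equation `K_{a;b} + K_{b;a} = 0`, that is, `g(∇_u K, v) + g(∇_v K, u) = 0` for all
tangent vectors `u`, `v`. -/
def IsKilling (K : Π x : M, TangentSpace I x) : Prop :=
  ∀ (x : M) (u v : TangentSpace I x),
    g.form x (g.leviCivita K x u) v + g.form x (g.leviCivita K x v) u = 0

end PseudoRiemannianMetric

section VectorFields

variable {E : Type*} [NormedAddCommGroup E] [NormedSpace ℝ E] [FiniteDimensional ℝ E]
  {H : Type*} [TopologicalSpace H] {I : ModelWithCorners ℝ E H}
  {M : Type*} [TopologicalSpace M] [ChartedSpace H M] [IsManifold I ∞ M]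

theorem two_le_infty : (2 : ℕ∞ω) ≤ ∞ := by
  exact (inferInstance : ENat.LEInfty 2).out

theorem contMDiffAt_mlieBracket {X Y : Π x : M, TangentSpace I x} {x : M}
    (hX : CMDiffAt ∞ (T% X) x) (hY : CMDiffAt ∞ (T% Y) x) :
    CMDiffAt ∞ (T% (mlieBracket I X Y)) x := by
  have := FiniteDimensional.complete ℝ E
  have : IsManifold I (minSmoothness ℝ 2) M := by simpa using inferInstanceAs (IsManifold I 2 M)
  have : IsManifold I (((⊤ : ℕ∞) : ℕ∞ω) + 1) M := inferInstanceAs (IsManifold I ∞ M)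
  exact ContMDiffAt.mlieBracket_vectorField (m := ⊤) (n := ⊤) hX hY (by simp)

variable (I M) in
/-- The smooth vector fields on `M`. -/
abbrev SmoothVectorField := Cₛ^∞⟮I; E, (TangentSpace I : M → Type _)⟯

namespace SmoothVectorField

theorem mdifferentiableAt (X : SmoothVectorField I M) (x : M) : MDiffAt (T% (X : Π y, TangentSpace I y)) x :=
  (X.contMDiff x).mdifferentiableAt (by simp)

/-- The Lie bracket of smooth vector fields. -/
instance : Bracket (SmoothVectorField I M) (SmoothVectorField I M) where
  bracket X Y := ⟨mlieBracket I X Y, fun x ↦ contMDiffAt_mlieBracket (X.contMDiff x) (Y.contMDiff x)⟩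

theorem bracket_apply (X Y : SmoothVectorField I M) (x : M) :
    ⁅X, Y⁆ x = mlieBracket I X Y x := rfl

instance : LieRing (SmoothVectorField I M) where
  add_lie X Y Z := by
    have := FiniteDimensional.complete ℝ E
    ext x
    exact mlieBracket_add_left (X.mdifferentiableAt x) (Y.mdifferentiableAt x)
  lie_add X Y Z := by
    have := FiniteDimensional.complete ℝ E
    ext x
    exact mlieBracket_add_right (Y.mdifferentiableAt x) (Z.mdifferentiableAt x)
  lie_self X := by
    ext x
    simp [bracket_apply]
  leibniz_lie X Y Z := by
    have := FiniteDimensional.complete ℝ E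
    have : IsManifold I (minSmoothness ℝ 3) M := by
      simpa using inferInstanceAs (IsManifold I 3 M)
    ext x
    refine leibniz_identity_mlieBracket_apply (U := X) (V := Y) (W := Z) ?_ ?_ ?_
    · exact (X.contMDiff x).of_le (by simpa using two_le_infty)
    · exact (Y.contMDiff x).of_le (by simpa using two_le_infty)
    · exact (Z.contMDiff x).of_le (by simpa using two_le_infty)

instance : LieAlgebra ℝ (SmoothVectorField I M) where
  lie_smul c X Y := by
    have := FiniteDimensional.complete ℝ E
    ext x
    exact mlieBracket_const_smul_right (Y.mdifferentiableAt x)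

end SmoothVectorField

theorem eventually_mdifferentiableAt {X : Π x : M, TangentSpace I x} {x : M}
    (hX : CMDiffAt ∞ (T% X) x) : ∀ᶠ y in nhds x, MDiffAt (T% X) y := by
  have h1 : CMDiffAt 1 (T% X) x := hX.of_le (by simp)
  filter_upwards [(contMDiffAt_iff_contMDiffAt_nhds (by simp)).1 h1] with y hy
  exact hy.mdifferentiableAt (by simp)

/-- The bracket acts on functions as the commutator of derivations. -/
theorem mvfderiv_mlieBracket {X Y : Π x : M, TangentSpace I x} {f a b : M → ℝ} {x : M}
    (hX : CMDiffAt ∞ (T% X) x) (hY : CMDiffAt ∞ (T% Y) x) (hf : CMDiffAt ∞ f x)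
    (ha : MDiffAt a x) (hb : MDiffAt b x)
    (hXf : ∀ᶠ y in nhds x, d% f y (X y) = a y) (hYf : ∀ᶠ y in nhds x, d% f y (Y y) = b y) :
    d% f x (mlieBracket I X Y x) = d% b x (X x) - d% a x (Y x) := by
  have := FiniteDimensional.complete ℝ E
  have : IsManifold I (minSmoothness ℝ 3) M := by
    simpa using inferInstanceAs (IsManifold I 3 M)
  rcases subsingleton_or_nontrivial (TangentSpace I x) with hs | hn
  · rw [Subsingleton.elim (mlieBracket I X Y x) 0, Subsingleton.elim (X x) 0,
      Subsingleton.elim (Y x) 0]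
    simp
  obtain ⟨w, hw⟩ := exists_ne (0 : TangentSpace I x)
  set W := FiberBundle.extend E w with hWdef
  have hWw : W x = w := by simp [W]
  have hW : CMDiffAt ∞ (T% W) x := FiberBundle.contMDiffAt_extend ..
  have hfW : CMDiffAt ∞ (T% (f • W)) x := hf.smul_section hW
  have hfd : ∀ᶠ y in nhds x, MDiffAt f y := by
    filter_upwards [(contMDiffAt_iff_contMDiffAt_nhds (by simp)).1
      (hf.of_le (by simp : (1 : ℕ∞ω) ≤ ∞))] with y hy
    exact hy.mdifferentiableAt (by simp)
  have hWd := eventually_mdifferentiableAt hW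
  have key : ∀ (V : Π x : M, TangentSpace I x) (c : M → ℝ), CMDiffAt ∞ (T% V) x →
      (∀ᶠ y in nhds x, d% f y (V y) = c y) →
      ∀ᶠ y in nhds x, mlieBracket I V (f • W) y = (c • W + f • mlieBracket I V W) y := by
    intro V c hV hc
    filter_upwards [hc, hfd, hWd] with y h1 h2 h3
    rw [mlieBracket_smul_right h2 h3, h1]
    rfl
  have second : ∀ (U V : Π x : M, TangentSpace I x) (c : M → ℝ), CMDiffAt ∞ (T% U) x →
      CMDiffAt ∞ (T% V) x → MDiffAt c x → (∀ᶠ y in nhds x, d% f y (V y) = c y) →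
      mlieBracket I U (mlieBracket I V (f • W)) x =
        d% c x (U x) • w + c x • mlieBracket I U W x + d% f x (U x) • mlieBracket I V W x
          + f x • mlieBracket I U (mlieBracket I V W) x := by
    intro U V c hU hV hc hVf
    have hVW := contMDiffAt_mlieBracket hV hW
    rw [Filter.EventuallyEq.mlieBracket_vectorField_eq (Filter.EventuallyEq.refl _ U)
      (key V c hV hVf)]
    have h1 : MDiffAt (T% (c • W)) x := hc.smul_section hWd.self_of_nhds
    have h2 : MDiffAt (T% (f • mlieBracket I V W)) x :=
      hfd.self_of_nhds.smul_section (eventually_mdifferentiableAt hVW).self_of_nhds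
    rw [mlieBracket_add_right h1 h2, mlieBracket_smul_right hc hWd.self_of_nhds,
      mlieBracket_smul_right hfd.self_of_nhds (eventually_mdifferentiableAt hVW).self_of_nhds, hWw]
    abel
  have two : ∀ {V : Π x : M, TangentSpace I x}, CMDiffAt ∞ (T% V) x →
      CMDiffAt (minSmoothness ℝ 2) (T% V) x := fun h ↦ h.of_le (by simpa using two_le_infty)
  have J1 := leibniz_identity_mlieBracket_apply (two hX) (two hY) (two hfW)
  have J2 := leibniz_identity_mlieBracket_apply (two hX) (two hY) (two hW)
  rw [second X Y b hX hY hb hYf, second Y X a hY hX ha hXf,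
    mlieBracket_smul_right hfd.self_of_nhds hWd.self_of_nhds, J2, hWw,
    hXf.self_of_nhds, hYf.self_of_nhds] at J1
  have h0 : (d% b x (X x) - d% a x (Y x) - d% f x (mlieBracket I X Y x)) • w = 0 := by
    rw [← sub_eq_zero] at J1
    rw [← J1]
    module
  have h1 := (smul_eq_zero.1 h0).resolve_right hw
  linarith

end VectorFields

namespace PseudoRiemannianMetric

variable {E : Type*} [NormedAddCommGroup E] [NormedSpace ℝ E] [FiniteDimensional ℝ E]
  {H : Type*} [TopologicalSpace H] {I : ModelWithCorners ℝ E H}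
  {M : Type*} [TopologicalSpace M] [ChartedSpace H M] [IsManifold I ∞ M]
  {p q : ℕ} (g : PseudoRiemannianMetric I M p q)

theorem lieDerivative_form {K X Y : Π x : M, TangentSpace I x} {x : M}
    (hK : MDiffAt (T% K) x) (hX : MDiffAt (T% X) x) (hY : MDiffAt (T% Y) x) :
    d% (g.pair X Y) x (K x) = g.form x (mlieBracket I K X x) (Y x)
      + g.form x (X x) (mlieBracket I K Y x)
      + (g.form x (g.leviCivita K x (X x)) (Y x) + g.form x (g.leviCivita K x (Y x)) (X x)) := by
  rw [g.leviCivita_metric hK hX hY, ← g.leviCivita_torsion hK hX, ← g.leviCivita_torsion hK hY]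
  simp only [map_sub, sub_apply, g.symm x (X x)]
  ring

theorem IsKilling.bracket {g : PseudoRiemannianMetric I M p q} {K L : SmoothVectorField I M}
    (hK : g.IsKilling K) (hL : g.IsKilling L) : g.IsKilling (⁅K, L⁆ : SmoothVectorField I M) := by
  have := FiniteDimensional.complete ℝ E
  have : IsManifold I (minSmoothness ℝ 3) M := by
    simpa using inferInstanceAs (IsManifold I 3 M)
  intro x u v
  set X := FiberBundle.extend E u
  set Y := FiberBundle.extend E v
  have hXu : X x = u := by simp [X]
  have hYv : Y x = v := by simp [Y]
  have hX : CMDiffAt ∞ (T% X) x := FiberBundle.contMDiffAt_extend ..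
  have hY : CMDiffAt ∞ (T% Y) x := FiberBundle.contMDiffAt_extend ..
  have hd : ∀ {V : Π x : M, TangentSpace I x}, CMDiffAt ∞ (T% V) x → MDiffAt (T% V) x :=
    fun h ↦ (eventually_mdifferentiableAt h).self_of_nhds
  have two : ∀ {V : Π x : M, TangentSpace I x}, CMDiffAt ∞ (T% V) x →
      CMDiffAt (minSmoothness ℝ 2) (T% V) x := fun h ↦ h.of_le (by simpa using two_le_infty)
  -- the Lie derivative of the metric along a Killing field vanishes
  have lie : ∀ {K : SmoothVectorField I M}, g.IsKilling K → ∀ {X Y : Π x : M, TangentSpace I x}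
      {y : M}, MDiffAt (T% X) y → MDiffAt (T% Y) y → d% (g.pair X Y) y (K y) =
        g.pair (mlieBracket I K X) Y y + g.pair X (mlieBracket I K Y) y := by
    intro K hK X Y y hX hY
    rw [g.lieDerivative_form (K.mdifferentiableAt y) hX hY, hK, add_zero]
    rfl
  have ev : ∀ {K : SmoothVectorField I M}, g.IsKilling K → ∀ᶠ y in nhds x,
      d% (g.pair X Y) y (K y) =
        g.pair (mlieBracket I K X) Y y + g.pair X (mlieBracket I K Y) y := by
    intro K hK
    filter_upwards [eventually_mdifferentiableAt hX, eventually_mdifferentiableAt hY] with y h1 h2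
    exact lie hK h1 h2
  have br : ∀ (K : SmoothVectorField I M) {V : Π x : M, TangentSpace I x},
      CMDiffAt ∞ (T% V) x → CMDiffAt ∞ (T% (mlieBracket I K V)) x :=
    fun K _ h ↦ contMDiffAt_mlieBracket (K.contMDiff x) h
  have dp : ∀ (K : SmoothVectorField I M), MDiffAt (g.pair (mlieBracket I K X) Y) x ∧
      MDiffAt (g.pair X (mlieBracket I K Y)) x := fun K ↦
    ⟨g.mdifferentiableAt_pair (hd (br K hX)) (hd hY),
      g.mdifferentiableAt_pair (hd hX) (hd (br K hY))⟩
  have comm := mvfderiv_mlieBracket (K.contMDiff x) (L.contMDiff x) (g.contMDiffAt_pair hX hY)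
    ((dp K).1.add (dp K).2) ((dp L).1.add (dp L).2) (ev hK) (ev hL)
  have e1 := mvfderiv_fun_add (dp K).1 (dp K).2
  have e2 := mvfderiv_fun_add (dp L).1 (dp L).2
  have JX := leibniz_identity_mlieBracket_apply (two (K.contMDiff x)) (two (L.contMDiff x)) (two hX)
  have JY := leibniz_identity_mlieBracket_apply (two (K.contMDiff x)) (two (L.contMDiff x)) (two hY)
  have main := g.lieDerivative_form (⁅K, L⁆.mdifferentiableAt x) (hd hX) (hd hY)
  rw [hXu, hYv] at main
  have expand : ∀ (P Q : SmoothVectorField I M), g.IsKilling P →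
      d% (fun y ↦ g.pair (mlieBracket I Q X) Y y + g.pair X (mlieBracket I Q Y) y) x (P x) =
        g.form x (mlieBracket I P (mlieBracket I Q X) x) v
        + g.form x (mlieBracket I Q X x) (mlieBracket I P Y x)
        + g.form x (mlieBracket I P X x) (mlieBracket I Q Y x)
        + g.form x u (mlieBracket I P (mlieBracket I Q Y) x) := by
    intro P Q hP
    rw [mvfderiv_fun_add (dp Q).1 (dp Q).2, add_apply, lie hP (hd (br Q hX)) (hd hY),
      lie hP (hd hX) (hd (br Q hY))]
    simp only [pair, hXu, hYv]
    ring
  have comm' := comm.trans (congrArg₂ (· - ·) (expand K L hK) (expand L K hL))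
  rw [JX, JY] at comm'
  have h := main.symm.trans comm'
  simp only [map_add, add_apply] at h
  have hb : ((⁅K, L⁆ : SmoothVectorField I M) : Π x, TangentSpace I x) = mlieBracket I K L := rfl
  rw [hb] at h ⊢
  linarith

/-- The Lie algebra of (globally defined, smooth) Killing fields of `g`, a Lie subalgebra of the
Lie algebra of smooth vector fields. -/
def killingAlgebra : LieSubalgebra ℝ (SmoothVectorField I M) where
  carrier := {K | g.IsKilling K}
  add_mem' := by
    intro K L hK hL x u v
    have h := g.leviCivita.isCovariantDerivativeOnUniv.add (K.mdifferentiableAt x)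
      (L.mdifferentiableAt x)
    have h1 := hK x u v
    have h2 := hL x u v
    change g.form x (g.leviCivita.toFun (K + L) x u) v
      + g.form x (g.leviCivita.toFun (K + L) x v) u = 0
    rw [h]
    simp only [add_apply, map_add]
    linear_combination h1 + h2
  zero_mem' := by
    intro x u v
    have h : g.leviCivita ((0 : SmoothVectorField I M) : Π x, TangentSpace I x) x = 0 :=
      g.leviCivita.isCovariantDerivativeOnUniv.zero
    rw [h]
    simp
  smul_mem' := by
    intro c K hK x u v
    have h := g.leviCivita.isCovariantDerivativeOnUniv.smul_const c (K.mdifferentiableAt x)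
    have h1 := hK x u v
    change g.form x (g.leviCivita.toFun (c • K) x u) v
      + g.form x (g.leviCivita.toFun (c • K) x v) u = 0
    rw [h]
    simp only [smul_apply, map_smul, smul_eq_mul]
    linear_combination c * h1
  lie_mem' := fun hK hL ↦ hK.bracket hL

end PseudoRiemannianMetric

section Euclidean

/-- The abelian Lie algebra `ℝⁿ`, `n = p + q`, of the group of translations of `ℝⁿ`. -/
def Translations (p q : ℕ) : Type := Fin p ⊕ Fin q → ℝ

instance (p q : ℕ) : AddCommGroup (Translations p q) :=
  inferInstanceAs (AddCommGroup (Fin p ⊕ Fin q → ℝ))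

instance (p q : ℕ) : Module ℝ (Translations p q) :=
  inferInstanceAs (Module ℝ (Fin p ⊕ Fin q → ℝ))

instance (p q : ℕ) : LieRing (Translations p q) where
  bracket _ _ := 0
  add_lie _ _ _ := (add_zero 0).symm
  lie_add _ _ _ := (add_zero 0).symm
  lie_self _ := rfl
  leibniz_lie _ _ _ := (add_zero 0).symm

instance (p q : ℕ) : LieAlgebra ℝ (Translations p q) where
  lie_smul c _ _ := (smul_zero c).symm

/-- The matrix group `SO(p, q)`, as a set of matrices. -/
def specialIndefiniteOrthogonal (p q : ℕ) : Set (Matrix (Fin p ⊕ Fin q) (Fin p ⊕ Fin q) ℝ) :=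
  {A | A.transpose * LieAlgebra.Orthogonal.indefiniteDiagonal (Fin p) (Fin q) ℝ * A =
      LieAlgebra.Orthogonal.indefiniteDiagonal (Fin p) (Fin q) ℝ ∧ A.det = 1}

open scoped Matrix.Norms.Operator in
/-- The Lie algebra `so(p, q)` consists of the matrices `A` whose one-parameter group
`t ↦ exp (t A)` lies in `SO(p, q)`. -/
theorem mem_so_iff (p q : ℕ) (A : Matrix (Fin p ⊕ Fin q) (Fin p ⊕ Fin q) ℝ) :
    A ∈ LieAlgebra.Orthogonal.so' (Fin p) (Fin q) ℝ ↔
      ∀ t : ℝ, NormedSpace.exp (t • A) ∈ specialIndefiniteOrthogonal p q := by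
  set J := LieAlgebra.Orthogonal.indefiniteDiagonal (Fin p) (Fin q) ℝ with hJ
  have hJJ : J * J = 1 := by
    rw [hJ, LieAlgebra.Orthogonal.indefiniteDiagonal, Matrix.diagonal_mul_diagonal,
      ← Matrix.diagonal_one]
    congr 1
    funext i
    rcases i with i | i <;> simp
  have hmem : A ∈ LieAlgebra.Orthogonal.so' (Fin p) (Fin q) ℝ ↔ A.transpose * J = J * (-A) := by
    rw [LieAlgebra.Orthogonal.so', mem_skewAdjointMatricesLieSubalgebra]
    exact mem_skewAdjointMatricesSubmodule _ _
  have hU : IsUnit J := ⟨⟨J, J, hJJ, hJJ⟩, rfl⟩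
  have hinv : J⁻¹ = J := Matrix.inv_eq_right_inv hJJ
  rw [hmem]
  constructor
  · intro h
    have hA : A.transpose = J * (-A) * J := by rw [← h, mul_assoc, hJJ, mul_one]
    have key : ∀ t : ℝ, (NormedSpace.exp (t • A)).transpose * J * NormedSpace.exp (t • A) = J := by
      intro t
      have h1 : (t • A).transpose = J * (-(t • A)) * J⁻¹ := by
        rw [Matrix.transpose_smul, hA, hinv]; simp
      rw [← Matrix.exp_transpose, h1, Matrix.exp_conj _ _ hU, hinv, mul_assoc (J * _) J J, hJJ,
        mul_one, mul_assoc, Matrix.exp_neg, Matrix.nonsing_inv_mul, mul_one]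
      exact (Matrix.isUnit_iff_isUnit_det _).1 (Matrix.isUnit_exp _)
    intro t
    refine ⟨key t, ?_⟩
    have h2 : NormedSpace.exp (t • A) = NormedSpace.exp ((t / 2) • A) * NormedSpace.exp ((t / 2) • A) := by
      rw [← Matrix.exp_add_of_commute _ _ (Commute.refl _), ← add_smul, add_halves]
    have h3 := congrArg Matrix.det (key (t / 2))
    simp only [Matrix.det_mul, Matrix.det_transpose] at h3
    have h4 : J.det ≠ 0 := ((Matrix.isUnit_iff_isUnit_det _).1 hU).ne_zero
    rw [h2, Matrix.det_mul]
    apply mul_right_cancel₀ h4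
    linear_combination h3
  · intro h
    have hd : ∀ B : Matrix (Fin p ⊕ Fin q) (Fin p ⊕ Fin q) ℝ,
        HasDerivAt (fun t : ℝ ↦ NormedSpace.exp (t • B)) B 0 := by
      intro B
      have hB := hasDerivAt_exp_smul_const (𝕂 := ℝ) B (0 : ℝ)
      rw [zero_smul, NormedSpace.exp_zero, one_mul] at hB
      exact hB
    have e : (fun t : ℝ ↦ NormedSpace.exp (t • A.transpose) * J) = fun t : ℝ ↦ J * NormedSpace.exp (t • (-A)) := by
      funext t
      have h1 := (h t).1
      have h2 : NormedSpace.exp (t • A) * NormedSpace.exp (t • (-A)) = 1 := by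
        rw [smul_neg, Matrix.exp_neg, Matrix.mul_nonsing_inv]
        exact (Matrix.isUnit_iff_isUnit_det _).1 (Matrix.isUnit_exp _)
      calc NormedSpace.exp (t • A.transpose) * J = (NormedSpace.exp (t • A)).transpose * J := by
            rw [← Matrix.exp_transpose, Matrix.transpose_smul]
        _ = (NormedSpace.exp (t • A)).transpose * J * (NormedSpace.exp (t • A) * NormedSpace.exp (t • (-A))) := by rw [h2, mul_one]
        _ = J * NormedSpace.exp (t • (-A)) := by rw [← mul_assoc, h1]
    have d1 := (hd A.transpose).mul_const J
    have d2 := (hd (-A)).const_mul J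
    rw [e] at d1
    exact d1.unique d2

/-- The standard action of `so(p, q)` on `ℝⁿ` by matrix multiplication. -/
def soAction (p q : ℕ) : LieAlgebra.Orthogonal.so' (Fin p) (Fin q) ℝ →ₗ⁅ℝ⁆
    LieDerivation ℝ (Translations p q) (Translations p q) where
  toFun A :=
    { toLinearMap := (Matrix.mulVecLin A.1 : (Fin p ⊕ Fin q → ℝ) →ₗ[ℝ] (Fin p ⊕ Fin q → ℝ))
      leibniz' := fun _ _ ↦ (Matrix.mulVec_zero A.1).trans (sub_zero 0).symm }
  map_add' A B := by
    ext v
    exact Matrix.add_mulVec A.1 B.1 v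
  map_smul' c A := by
    ext v
    exact Matrix.smul_mulVec c A.1 v
  map_lie' := by
    intro A B
    ext v
    exact (Matrix.sub_mulVec (A.1 * B.1) (B.1 * A.1) v).trans
      (congrArg₂ (fun a b : Fin p ⊕ Fin q → ℝ ↦ a - b)
        (Matrix.mulVec_mulVec v A.1 B.1).symm (Matrix.mulVec_mulVec v B.1 A.1).symm)

/-- The Lie algebra `ℝⁿ ⋊ so(p, q)`, `n = p + q`, of the semidirect product Lie group
`ℝⁿ ⋊ SO(p, q)`, with bracket `[(v, A), (w, B)] = (A w - B v, A B - B A)`. -/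
abbrev EuclideanLieAlgebra (p q : ℕ) : Type :=
  LieAlgebra.SemiDirectSum (Translations p q)
    (LieAlgebra.Orthogonal.so' (Fin p) (Fin q) ℝ) (soAction p q)

end Euclidean

end

/-!
A Killing field `K` on a connected manifold is determined by its 1-jet `(K(x), ∇K(x))` at any point
`x`, and Killing's equation says that `∇K(x)` is skew-symmetric for the metric. In an orthonormal
basis of the tangent space at `x` this identifies the space of Killing fields with a subspace of
`ℝⁿ × so(p, q)`. If the curvature vanishes at `x`, then `K ↦ (K(x), -∇K(x))` is moreover a
homomorphism into `ℝⁿ ⋊ so(p, q)`.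

Homomorphism (`killingHom`). Consider the trilinear form `g(∇²_{X, Y} K, Z)` at `x`, where
`∇²_{X, Y} K = ∇_X ∇_Y K - ∇_{∇_X Y} K`. It is skew-symmetric in `Y` and `Z` by Killing's equation
(`IsKilling.form_second_deriv_skew`), and symmetric in `X` and `Y` because the curvature is zero at
`x`, so it vanishes (`IsKilling.second_deriv_eq_zero`). Hence, differentiating
`[K, L] = ∇_K L - ∇_L K`, one gets `∇[K, L] = ∇L ∘ ∇K - ∇K ∘ ∇L` at `x`
(`IsKilling.leviCivita_bracket`). The fields being differentiated here are smooth because Koszul's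
formula makes their scalar products with smooth fields smooth (`contMDiffAt_leviCivita`).

Injectivity (`IsKilling.eq_zero`). In a chart with metric `G`, Killing's equation for the
representation `k` of `K` is `DG(k) u v + G(Dk u, v) + G(Dk v, u) = 0`. Differentiating it and
permuting the arguments, as in the derivation of the Christoffel symbols, expresses `D²k` linearly
through `k` and `Dk` (`abs_killing_second_deriv_le`). By Grönwall's inequality along segments, `k`
vanishes near every point where `k` and `Dk` are zero (`eventually_eq_zero_of_killing_eq`).
Therefore the interior of the zero set of `K` is closed, and by connectedness it is all of `M` as
soon as the 1-jet of `K` vanishes at one point.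
-/

noncomputable section

/-! ### Killing's equation on a vector space -/

section Prolongation

set_option maxSynthPendingDepth 3
set_option synthInstance.maxHeartbeats 100000

variable {E F : Type*} [NormedAddCommGroup E] [NormedSpace ℝ E]
  [NormedAddCommGroup F] [NormedSpace ℝ F]

/-- Grönwall's inequality along the segments issuing from `x`. -/
theorem eventually_eq_zero_of_norm_fderiv_le {f : E → F} {x : E} {C : ℝ}
    (hf : ∀ᶠ y in nhds x, DifferentiableAt ℝ f y ∧ ‖fderiv ℝ f y‖ ≤ C * ‖f y‖) (hx : f x = 0) :
    ∀ᶠ y in nhds x, f y = 0 := by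
  obtain ⟨r, hr, hball⟩ := Metric.eventually_nhds_iff_ball.1 hf
  filter_upwards [Metric.ball_mem_nhds x hr] with y hy
  have hmem : ∀ t ∈ Set.Icc (0 : ℝ) 1, x + t • (y - x) ∈ Metric.ball x r := by
    intro t ht
    exact (convex_ball x r).add_smul_sub_mem (Metric.mem_ball_self hr) hy ht
  have hline : ∀ t : ℝ, HasDerivAt (fun t : ℝ ↦ x + t • (y - x)) (y - x) t := fun t ↦ by
    simpa using ((hasDerivAt_id t).smul_const (y - x)).const_add x
  have hder : ∀ t ∈ Set.Icc (0 : ℝ) 1, HasDerivAt (fun t : ℝ ↦ f (x + t • (y - x)))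
      (fderiv ℝ f (x + t • (y - x)) (y - x)) t := fun t ht ↦
    (hball _ (hmem t ht)).1.hasFDerivAt.comp_hasDerivAt t (hline t)
  have h := eq_zero_of_abs_deriv_le_mul_abs_self_of_eq_zero_right (K := C * ‖y - x‖)
    (fun t ht ↦ (hder t ht).continuousAt.continuousWithinAt)
    (fun t ht ↦ (hder t ⟨ht.1, ht.2.le⟩).hasDerivWithinAt) (by simp [hx])
    (fun t ht ↦ by
      refine (ContinuousLinearMap.le_opNorm _ _).trans ?_
      have := mul_le_mul_of_nonneg_right (hball _ (hmem t ⟨ht.1, ht.2.le⟩)).2 (norm_nonneg (y - x))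
      linarith) 1 (by simp)
  simpa using h

/-- A `C²` map is twice differentiable near the point, with bounded derivatives. -/
theorem ContDiffAt.eventually_norm_fderiv_le {f : E → F} {x : E}
    (hf : ContDiffAt ℝ 2 f x) : ∃ A, 0 ≤ A ∧ ∀ᶠ y in nhds x, DifferentiableAt ℝ f y ∧
      DifferentiableAt ℝ (fderiv ℝ f) y ∧ ‖fderiv ℝ f y‖ ≤ A ∧ ‖fderiv ℝ (fderiv ℝ f) y‖ ≤ A := by
  have h1 : ContDiffAt ℝ 1 (fderiv ℝ f) x := hf.fderiv_right (by norm_num)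
  have h2 : ContDiffAt ℝ 0 (fderiv ℝ (fderiv ℝ f)) x := h1.fderiv_right (by norm_num)
  refine ⟨max (‖fderiv ℝ f x‖ + 1) (‖fderiv ℝ (fderiv ℝ f) x‖ + 1),
    le_max_of_le_left (by positivity), ?_⟩
  filter_upwards [hf.eventually (by simp), h1.eventually (by simp),
    h1.continuousAt.norm.eventually_lt_const (lt_add_one _),
    h2.continuousAt.norm.eventually_lt_const (lt_add_one _)] with y g1 g2 g3 g4
  exact ⟨g1.differentiableAt (by simp), g2.differentiableAt (by simp),
    le_max_of_le_left g3.le, le_max_of_le_right g4.le⟩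

theorem abs_apply₃_le (B : E →L[ℝ] E →L[ℝ] E →L[ℝ] ℝ) (a u v : E) :
    |B a u v| ≤ ‖B‖ * ‖a‖ * ‖u‖ * ‖v‖ := by
  refine ((B a).le_opNorm₂ u v).trans ?_
  gcongr
  exact B.le_opNorm a

theorem abs_apply₄_le (B : E →L[ℝ] E →L[ℝ] E →L[ℝ] E →L[ℝ] ℝ) (w a u v : E) :
    |B w a u v| ≤ ‖B‖ * ‖w‖ * ‖a‖ * ‖u‖ * ‖v‖ := by
  refine (abs_apply₃_le (B w) a u v).trans ?_
  gcongr
  exact B.le_opNorm w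

/-- The derivative in the direction `w` of Killing's equation, with the second order terms on the
left. -/
theorem killing_eq_deriv {G : E → E →L[ℝ] E →L[ℝ] ℝ} {k : E → E} {y : E}
    (hG : DifferentiableAt ℝ G y) (hG' : DifferentiableAt ℝ (fderiv ℝ G) y)
    (hk : DifferentiableAt ℝ k y) (hk' : DifferentiableAt ℝ (fderiv ℝ k) y)
    (hkill : ∀ᶠ z in nhds y, ∀ u v, fderiv ℝ G z (k z) u v + G z (fderiv ℝ k z u) v
      + G z (fderiv ℝ k z v) u = 0) (w u v : E) :
    G y (fderiv ℝ (fderiv ℝ k) y w u) v + G y (fderiv ℝ (fderiv ℝ k) y w v) u =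
      -(fderiv ℝ (fderiv ℝ G) y w (k y) u v + fderiv ℝ G y (fderiv ℝ k y w) u v
        + fderiv ℝ G y w (fderiv ℝ k y u) v + fderiv ℝ G y w (fderiv ℝ k y v) u) := by
  have h1 : HasFDerivAt (fun z ↦ fderiv ℝ G z (k z) u v + G z (fderiv ℝ k z u) v
      + G z (fderiv ℝ k z v) u) (0 : E →L[ℝ] ℝ) y := by
    refine (hasFDerivAt_const (0 : ℝ) y).congr_of_eventuallyEq ?_
    filter_upwards [hkill] with z hz using hz u v
  have term : ∀ a b : E, HasFDerivAt (fun z ↦ G z (fderiv ℝ k z a) b) _ y := fun a b ↦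
    (hG.hasFDerivAt.clm_apply (hk'.hasFDerivAt.clm_apply (hasFDerivAt_const a y))).clm_apply
      (hasFDerivAt_const b y)
  have h2 := ((((hG'.hasFDerivAt.clm_apply hk.hasFDerivAt).clm_apply
    (hasFDerivAt_const u y)).clm_apply (hasFDerivAt_const v y)).add (term u v)).add (term v u)
  have h3 := congrArg (fun φ : E →L[ℝ] ℝ ↦ φ w) (h2.unique h1)
  simp at h3
  linarith

/-- The second derivatives of a solution of Killing's equation are controlled by the solution and
its first derivatives: if `T w u v = g(∂_w ∂_u k, v)`, then Killing's equation expresses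
`Q w u v = T w u v + T w v u` through lower order terms, and by the symmetry of `T` in its
first two arguments `2 T w u v = Q w u v + Q u w v - Q v w u`. -/
theorem abs_killing_second_deriv_le {G : E → E →L[ℝ] E →L[ℝ] ℝ} {k : E → E} {y : E} {A : ℝ}
    (hA0 : 0 ≤ A)
    (hG : DifferentiableAt ℝ G y) (hG' : DifferentiableAt ℝ (fderiv ℝ G) y)
    (hk : ContDiffAt ℝ 2 k y) (hk' : DifferentiableAt ℝ (fderiv ℝ k) y)
    (hkill : ∀ᶠ z in nhds y, ∀ u v, fderiv ℝ G z (k z) u v + G z (fderiv ℝ k z u) v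
      + G z (fderiv ℝ k z v) u = 0)
    (hA : ‖fderiv ℝ G y‖ ≤ A) (hA' : ‖fderiv ℝ (fderiv ℝ G) y‖ ≤ A) (w u v : E) :
    |G y (fderiv ℝ (fderiv ℝ k) y w u) v| ≤
      3 * (A * ‖k y‖ + 3 * A * ‖fderiv ℝ k y‖) * ‖w‖ * ‖u‖ * ‖v‖ := by
  have hsymm : ∀ a b, fderiv ℝ (fderiv ℝ k) y a b = fderiv ℝ (fderiv ℝ k) y b a :=
    hk.isSymmSndFDerivAt (by simp)
  have key := killing_eq_deriv hG hG' (hk.differentiableAt (by simp)) hk' hkill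
  have b1 : ∀ a b c : E, |fderiv ℝ G y a b c| ≤ A * ‖a‖ * ‖b‖ * ‖c‖ := fun a b c ↦
    (abs_apply₃_le _ a b c).trans (by gcongr)
  have b2 : ∀ a b c d : E, |fderiv ℝ (fderiv ℝ G) y a b c d| ≤ A * ‖a‖ * ‖b‖ * ‖c‖ * ‖d‖ :=
    fun a b c d ↦ (abs_apply₄_le _ a b c d).trans (by gcongr)
  have bk : ∀ a : E, ‖fderiv ℝ k y a‖ ≤ ‖fderiv ℝ k y‖ * ‖a‖ := fun a ↦
    ContinuousLinearMap.le_opNorm _ a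
  have q : ∀ a b c : E, |G y (fderiv ℝ (fderiv ℝ k) y a b) c
      + G y (fderiv ℝ (fderiv ℝ k) y a c) b| ≤
      (A * ‖k y‖ + 3 * A * ‖fderiv ℝ k y‖) * ‖a‖ * ‖b‖ * ‖c‖ := by
    intro a b c
    rw [key, abs_neg]
    have e1 := b2 a (k y) b c
    have e2 : |fderiv ℝ G y (fderiv ℝ k y a) b c| ≤ A * (‖fderiv ℝ k y‖ * ‖a‖) * ‖b‖ * ‖c‖ :=
      (b1 _ _ _).trans (by gcongr; exact bk a)
    have e3 : |fderiv ℝ G y a (fderiv ℝ k y b) c| ≤ A * ‖a‖ * (‖fderiv ℝ k y‖ * ‖b‖) * ‖c‖ :=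
      (b1 _ _ _).trans (by gcongr; exact bk b)
    have e4 : |fderiv ℝ G y a (fderiv ℝ k y c) b| ≤ A * ‖a‖ * (‖fderiv ℝ k y‖ * ‖c‖) * ‖b‖ :=
      (b1 _ _ _).trans (by gcongr; exact bk c)
    refine (abs_add_le _ _).trans ((add_le_add ((abs_add_le _ _).trans
      (add_le_add ((abs_add_le _ _).trans (add_le_add e1 e2)) e3)) e4).trans (le_of_eq ?_))
    ring
  have h1 := abs_le.1 (q w u v)
  have h2 := abs_le.1 (q u w v)
  have h3 := abs_le.1 (q v w u)
  rw [hsymm u w] at h2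
  rw [hsymm v w, hsymm v u] at h3
  have hnn : 0 ≤ (A * ‖k y‖ + 3 * A * ‖fderiv ℝ k y‖) * ‖w‖ * ‖u‖ * ‖v‖ := by positivity
  rw [abs_le]
  constructor <;> nlinarith

/-- A solution of Killing's equation on an open subset of a vector space, with respect to a
nondegenerate metric `G`, vanishes near every point where it vanishes to first order. -/
theorem eventually_eq_zero_of_killing_eq [FiniteDimensional ℝ E]
    {G : E → E →L[ℝ] E →L[ℝ] ℝ} {k : E → E} {x : E}
    (hG : ContDiffAt ℝ 2 G x) (hk : ContDiffAt ℝ 2 k x) (hinj : Function.Injective (G x))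
    (hkill : ∀ᶠ y in nhds x, ∀ u v, fderiv ℝ G y (k y) u v + G y (fderiv ℝ k y u) v
      + G y (fderiv ℝ k y v) u = 0)
    (hk0 : k x = 0) (hk1 : fderiv ℝ k x = 0) : ∀ᶠ y in nhds x, k y = 0 := by
  obtain ⟨K, hK, hanti⟩ := LinearMap.exists_antilipschitzWith (G x : E →ₗ[ℝ] E →L[ℝ] ℝ)
    (LinearMap.ker_eq_bot.2 hinj)
  obtain ⟨A, hA, hGA⟩ := hG.eventually_norm_fderiv_le
  obtain ⟨_, _, hkA⟩ := hk.eventually_norm_fderiv_le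
  have hK0 : (0 : ℝ) < K := hK
  -- closeness to `G x` that makes `G y` bounded below by half the bound for `G x`
  have hGc : ∀ᶠ y in nhds x, ‖G y - G x‖ < (2 * K : ℝ)⁻¹ := by
    have := Metric.continuousAt_iff'.1 hG.continuousAt (2 * K : ℝ)⁻¹ (by positivity)
    simpa only [dist_eq_norm] using this
  have main := eventually_eq_zero_of_norm_fderiv_le (f := fun y ↦ (k y, fderiv ℝ k y)) (x := x)
    (C := 1 + 2 * K * (12 * A)) ?_ (by simp [hk0, hk1])
  · filter_upwards [main] with y hy using congrArg Prod.fst hy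
  filter_upwards [hGA, hkA, hk.eventually (by simp), hkill.eventually_nhds, hGc]
    with y ⟨h1, h2, h6, h7⟩ ⟨h3', h4, _, _⟩ h3 h5 h8
  have hd := h3'.hasFDerivAt.prodMk h4.hasFDerivAt
  refine ⟨hd.differentiableAt, ?_⟩
  rw [hd.fderiv]
  set N := ‖(k y, fderiv ℝ k y)‖
  have n1 : ‖k y‖ ≤ N := norm_fst_le (k y, fderiv ℝ k y)
  have n2 : ‖fderiv ℝ k y‖ ≤ N := norm_snd_le (k y, fderiv ℝ k y)
  have hN : 0 ≤ N := norm_nonneg _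
  have lower : ∀ ξ : E, ‖ξ‖ ≤ 2 * K * ‖G y ξ‖ := by
    intro ξ
    have l1 : ‖ξ‖ ≤ K * ‖G x ξ‖ := ContinuousLinearMap.bound_of_antilipschitz (G x) hanti ξ
    have l2 : ‖G x ξ‖ ≤ ‖G y ξ‖ + (2 * K : ℝ)⁻¹ * ‖ξ‖ := by
      have : G x ξ = G y ξ - (G y - G x) ξ := by simp
      rw [this]
      refine (norm_sub_le _ _).trans (add_le_add_right ?_ _)
      exact (ContinuousLinearMap.le_opNorm _ _).trans (by gcongr)
    have l3 := mul_le_mul_of_nonneg_left l2 hK0.le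
    have l4 : K * (2 * K : ℝ)⁻¹ = 2⁻¹ := by field_simp
    rw [mul_add, ← mul_assoc, l4] at l3
    linarith
  have second : ‖fderiv ℝ (fderiv ℝ k) y‖ ≤ 2 * K * (12 * A) * N := by
    refine ContinuousLinearMap.opNorm_le_bound₂ _ (by positivity) fun w u ↦ ?_
    refine (lower _).trans ?_
    have : ‖G y (fderiv ℝ (fderiv ℝ k) y w u)‖ ≤ 12 * A * N * ‖w‖ * ‖u‖ := by
      refine ContinuousLinearMap.opNorm_le_bound _ (by positivity) fun v ↦ ?_
      refine (abs_killing_second_deriv_le hA h1 h2 h3 h4 h5 h6 h7 w u v).trans ?_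
      have : A * ‖k y‖ + 3 * A * ‖fderiv ℝ k y‖ ≤ 4 * A * N := by
        nlinarith [mul_le_mul_of_nonneg_left n1 hA, mul_le_mul_of_nonneg_left n2 hA]
      -- the constant is `3 * (A + 3 * A)`
      have h9 : 3 * (A * ‖k y‖ + 3 * A * ‖fderiv ℝ k y‖) ≤ 12 * A * N := by linarith
      gcongr
    calc _ ≤ 2 * K * (12 * A * N * ‖w‖ * ‖u‖) := by gcongr
      _ = _ := by ring
  have hnn : 0 ≤ 2 * K * (12 * A) * N := by positivity
  rw [ContinuousLinearMap.opNorm_prod, norm_prod_le_iff]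
  constructor <;> linarith

end Prolongation

/-! ### Smoothness of the Levi-Civita connection -/

section Smoothness

set_option maxSynthPendingDepth 3

variable {E : Type*} [NormedAddCommGroup E] [NormedSpace ℝ E]
  {H : Type*} [TopologicalSpace H] {I : ModelWithCorners ℝ E H}
  {M : Type*} [TopologicalSpace M] [ChartedSpace H M]

/-- A field of linear maps on a finite-dimensional space is smooth if its values on all vectors
are. -/
theorem contMDiffAt_clm_of_apply [FiniteDimensional ℝ E] {F : Type*}
    [NormedAddCommGroup F] [NormedSpace ℝ F] {n : ℕ∞ω} {L : M → E →L[ℝ] F} {x : M}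
    (h : ∀ u, CMDiffAt n (fun m ↦ L m u) x) :
    CMDiffAt n L x := by
  let c := Module.finBasis ℝ E
  have hL : L = fun m ↦ ∑ i, ContinuousLinearMap.smulRightL ℝ E F
      (LinearMap.toContinuousLinearMap (c.coord i)) (L m (c i)) := by
    funext m
    refine ContinuousLinearMap.coe_injective (c.ext fun j ↦ ?_)
    simp [Finsupp.single_apply]
  rw [hL]
  refine ContMDiffAt.sum fun i _ ↦ ?_
  exact (ContinuousLinearMap.contMDiff _).contMDiffAt.comp x (h (c i))

variable [IsManifold I ∞ M]

/-- The derivative of a smooth function along a smooth vector field is smooth. -/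
theorem contMDiffAt_mvfderiv_apply {f : M → ℝ} {X : Π x : M, TangentSpace I x} {x : M}
    (hf : CMDiffAt ∞ f x) (hX : CMDiffAt ∞ (T% X) x) :
    CMDiffAt ∞ (fun y ↦ d% f y (X y)) x := by
  have h : CMDiffAt ∞ (fun y ↦ (⟨f y, mfderiv% f y (X y)⟩ : TangentBundle 𝓘(ℝ) ℝ)) x :=
    ContMDiffAt.clm_apply_of_inCoordinates (b₁ := id) (b₂ := f) (v := X)
      (ϕ := fun y ↦ mfderiv% f y) (hf.mfderiv_const (m := ∞) (by simp)) hX hf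
  exact (contMDiff_snd_tangentBundle_modelSpace ℝ 𝓘(ℝ)).contMDiffAt.comp x h

variable (I) in
/-- The coordinate vector field with constant components `u` in the preferred chart at `x`, extended
by zero outside the domain of the chart. -/
def coordField (x : M) (u : E) (m : M) : TangentSpace I m :=
  (trivializationAt E (TangentSpace I) x).symmL ℝ m u

theorem contMDiffAt_coordField {x m : M}
    (hm : m ∈ (trivializationAt E (TangentSpace I : M → Type _) x).baseSet) (u : E) :
    CMDiffAt ∞ (T% (coordField I x u)) m := by
  set e := trivializationAt E (TangentSpace I : M → Type _) x
  rw [e.contMDiffAt_section_iff hm]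
  refine (contMDiffAt_const (c := u)).congr_of_eventuallyEq ?_
  filter_upwards [e.open_baseSet.mem_nhds hm] with m hm
  change (e ⟨m, e.symmL ℝ m u⟩).2 = u
  rw [e.symmL_apply hm, e.apply_mk_symm hm]

end Smoothness

namespace PseudoRiemannianMetric

set_option maxSynthPendingDepth 3

variable {E : Type*} [NormedAddCommGroup E] [NormedSpace ℝ E]
  {H : Type*} [TopologicalSpace H] {I : ModelWithCorners ℝ E H}
  {M : Type*} [TopologicalSpace M] [ChartedSpace H M] [IsManifold I ∞ M]
  {p q : ℕ} (g : PseudoRiemannianMetric I M p q)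

/-- The Gram form of the metric with respect to the coordinate fields of the preferred chart at `x`,
a field of bilinear forms on the model vector space (zero outside the domain of the chart). -/
def gram (x m : M) : E →L[ℝ] E →L[ℝ] ℝ :=
  ContinuousLinearMap.precomp ℝ ((trivializationAt E (TangentSpace I) x).symmL ℝ m) ∘L
    g.form m ∘L (trivializationAt E (TangentSpace I) x).symmL ℝ m

theorem gram_injective {x m : M} (hm : m ∈ (trivializationAt E (TangentSpace I) x).baseSet) :
    Function.Injective (g.gram x m) := by
  intro u v h
  set e := trivializationAt E (TangentSpace I : M → Type _) x
  have h1 : e.symmL ℝ m u = e.symmL ℝ m v := by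
    apply g.eq_of_form_eq
    intro w
    have h2 : g.form m (e.symmL ℝ m u) (e.symmL ℝ m (e.continuousLinearMapAt ℝ m w)) =
        g.form m (e.symmL ℝ m v) (e.symmL ℝ m (e.continuousLinearMapAt ℝ m w)) :=
      congrArg (fun φ : E →L[ℝ] ℝ ↦ φ (e.continuousLinearMapAt ℝ m w)) h
    rwa [e.symmL_continuousLinearMapAt hm] at h2
  have h3 := congrArg (e.continuousLinearMapAt ℝ m) h1
  rwa [e.continuousLinearMapAt_symmL hm, e.continuousLinearMapAt_symmL hm] at h3

variable [FiniteDimensional ℝ E]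

theorem contMDiffAt_gram {x m : M}
    (hm : m ∈ (trivializationAt E (TangentSpace I : M → Type _) x).baseSet) :
    CMDiffAt ∞ (g.gram x) m :=
  contMDiffAt_clm_of_apply fun u ↦ contMDiffAt_clm_of_apply fun v ↦
    g.contMDiffAt_pair (contMDiffAt_coordField hm u) (contMDiffAt_coordField hm v)

/-- A vector field is smooth if its scalar products with all smooth vector fields are. -/
theorem contMDiffAt_of_pair {V : Π x : M, TangentSpace I x} {x : M}
    (h : ∀ Z : Π x : M, TangentSpace I x, CMDiffAt ∞ (T% Z) x → CMDiffAt ∞ (g.pair V Z) x) :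
    CMDiffAt ∞ (T% V) x := by
  have := FiniteDimensional.complete ℝ E
  set e := trivializationAt E (TangentSpace I : M → Type _) x
  rw [contMDiffAt_section]
  have hx : x ∈ e.baseSet := FiberBundle.mem_baseSet_trivializationAt' x
  let φ : M → E →L[ℝ] ℝ := fun m ↦ (g.form m (V m)).comp (e.symmL ℝ m)
  have hφ : CMDiffAt ∞ φ x := contMDiffAt_clm_of_apply fun u ↦
    h (coordField I x u) (contMDiffAt_coordField hx u)
  have equiv : ∀ m ∈ e.baseSet, (g.gram x m).IsInvertible := by
    intro m hm
    have hfr : Module.finrank ℝ E = Module.finrank ℝ (E →L[ℝ] ℝ) :=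
      Subspace.dual_finrank_eq.symm.trans
        (LinearMap.toContinuousLinearMap : (E →ₗ[ℝ] ℝ) ≃ₗ[ℝ] (E →L[ℝ] ℝ)).finrank_eq
    refine ⟨(LinearEquiv.ofInjectiveOfFinrankEq (g.gram x m : E →ₗ[ℝ] E →L[ℝ] ℝ)
      (g.gram_injective hm) hfr).toContinuousLinearEquiv, ?_⟩
    ext; rfl
  obtain ⟨A, hA⟩ := equiv x hx
  have hinv : CMDiffAt ∞ (fun m ↦ (g.gram x m).inverse) x := by
    have h1 := (contDiffAt_map_inverse (n := ∞) A).contMDiffAt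
    rw [hA] at h1
    exact h1.comp x (g.contMDiffAt_gram hx)
  refine (hinv.clm_apply hφ).congr_of_eventuallyEq ?_
  filter_upwards [e.open_baseSet.mem_nhds hx] with m hm
  obtain ⟨B, hB⟩ := equiv m hm
  have h2 : φ m = g.gram x m (e ⟨m, V m⟩).2 := by
    ext u
    change g.form m (V m) (e.symmL ℝ m u) =
      g.form m (e.symmL ℝ m (e ⟨m, V m⟩).2) (e.symmL ℝ m u)
    rw [e.symmL_apply hm (e ⟨m, V m⟩).2, e.symm_apply_apply_mk hm]
  rw [h2, ← hB, ContinuousLinearMap.inverse_equiv]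
  exact (B.symm_apply_apply _).symm

theorem contMDiffAt_koszul {X Y Z : Π x : M, TangentSpace I x} {x : M}
    (hX : CMDiffAt ∞ (T% X) x) (hY : CMDiffAt ∞ (T% Y) x) (hZ : CMDiffAt ∞ (T% Z) x) :
    CMDiffAt ∞ (g.koszul X Y Z) x := by
  have hd : ∀ {X Y Z : Π x : M, TangentSpace I x}, CMDiffAt ∞ (T% X) x → CMDiffAt ∞ (T% Y) x →
      CMDiffAt ∞ (T% Z) x → CMDiffAt ∞ (fun y ↦ d% (g.pair X Y) y (Z y)) x :=
    fun hX hY hZ ↦ contMDiffAt_mvfderiv_apply (g.contMDiffAt_pair hX hY) hZ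
  have hb : ∀ {X Y Z : Π x : M, TangentSpace I x}, CMDiffAt ∞ (T% X) x → CMDiffAt ∞ (T% Y) x →
      CMDiffAt ∞ (T% Z) x → CMDiffAt ∞ (fun y ↦ g.form y (mlieBracket I X Y y) (Z y)) x :=
    fun hX hY hZ ↦ g.contMDiffAt_pair (contMDiffAt_mlieBracket hX hY) hZ
  exact contMDiffAt_const.mul ((((((hd hY hZ hX).add (hd hX hZ hY)).sub (hd hX hY hZ)).add
    (hb hX hY hZ)).sub (hb hX hZ hY)).sub (hb hY hZ hX))

/-- The covariant derivative of a smooth vector field along a smooth vector field is smooth. -/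
theorem contMDiffAt_leviCivita {X Y : Π x : M, TangentSpace I x} {x : M}
    (hX : CMDiffAt ∞ (T% X) x) (hY : CMDiffAt ∞ (T% Y) x) :
    CMDiffAt ∞ (T% (fun y ↦ g.leviCivita Y y (X y))) x := by
  apply g.contMDiffAt_of_pair
  intro Z hZ
  refine (g.contMDiffAt_koszul hX hY hZ).congr_of_eventuallyEq ?_
  filter_upwards [eventually_mdifferentiableAt hX, eventually_mdifferentiableAt hY,
    eventually_mdifferentiableAt hZ] with y h1 h2 h3 using g.form_leviCivita h1 h2 h3

end PseudoRiemannianMetric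

/-! ### Second covariant derivatives of Killing fields -/

namespace PseudoRiemannianMetric

variable {E : Type*} [NormedAddCommGroup E] [NormedSpace ℝ E] [FiniteDimensional ℝ E]
  {H : Type*} [TopologicalSpace H] {I : ModelWithCorners ℝ E H}
  {M : Type*} [TopologicalSpace M] [ChartedSpace H M] [IsManifold I ∞ M]
  {p q : ℕ} {g : PseudoRiemannianMetric I M p q} {K L : SmoothVectorField I M} {x : M}

/-- The scalar product of `∇²_{X, Y} K = ∇_X ∇_Y K - ∇_{∇_X Y} K` with `Z` is skew-symmetric in
`Y` and `Z`, as one sees by differentiating Killing's equation. -/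
theorem IsKilling.form_second_deriv_skew (hK : g.IsKilling K) {X Y Z : Π x : M, TangentSpace I x}
    (hX : CMDiffAt ∞ (T% X) x) (hY : CMDiffAt ∞ (T% Y) x) (hZ : CMDiffAt ∞ (T% Z) x) :
    g.form x (g.leviCivita (fun y ↦ g.leviCivita K y (Y y)) x (X x)
      - g.leviCivita K x (g.leviCivita Y x (X x))) (Z x) =
    -g.form x (g.leviCivita (fun y ↦ g.leviCivita K y (Z y)) x (X x)
      - g.leviCivita K x (g.leviCivita Z x (X x))) (Y x) := by
  have hd : ∀ {V : Π x : M, TangentSpace I x}, CMDiffAt ∞ (T% V) x → MDiffAt (T% V) x :=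
    fun h ↦ h.mdifferentiableAt (by simp)
  have hYK := hd (g.contMDiffAt_leviCivita hY (K.contMDiff x))
  have hZK := hd (g.contMDiffAt_leviCivita hZ (K.contMDiff x))
  have h0 : (fun y ↦ g.pair (fun y ↦ g.leviCivita K y (Y y)) Z y
      + g.pair (fun y ↦ g.leviCivita K y (Z y)) Y y) = fun _ ↦ (0 : ℝ) :=
    funext fun y ↦ hK y (Y y) (Z y)
  have h1 := mvfderiv_fun_add (g.mdifferentiableAt_pair hYK (hd hZ))
    (g.mdifferentiableAt_pair hZK (hd hY))
  rw [h0] at h1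
  have h2 := congrArg (fun φ : TangentSpace I x →L[ℝ] ℝ ↦ φ (X x)) h1
  simp only [mvfderiv_const, add_apply, zero_apply, g.leviCivita_metric (hd hX) hYK (hd hZ),
    g.leviCivita_metric (hd hX) hZK (hd hY)] at h2
  have h3 := hK x (g.leviCivita Y x (X x)) (Z x)
  have h4 := hK x (g.leviCivita Z x (X x)) (Y x)
  simp only [map_sub, sub_apply]
  linarith

/-- Where the curvature vanishes, so do the second covariant derivatives of Killing fields: the
trilinear form `g(∇²_{X, Y} K, Z)` is symmetric in `X` and `Y` and skew-symmetric in `Y`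
and `Z`. -/
theorem IsKilling.second_deriv_eq_zero (hK : g.IsKilling K) (hx : g.CurvatureVanishesAt x)
    {X Y : Π x : M, TangentSpace I x}
    (hX : CMDiffAt ∞ (T% X) x) (hY : CMDiffAt ∞ (T% Y) x) :
    g.leviCivita (fun y ↦ g.leviCivita K y (Y y)) x (X x) =
      g.leviCivita K x (g.leviCivita Y x (X x)) := by
  let D : (X Y : Π x : M, TangentSpace I x) → TangentSpace I x := fun X Y ↦
    g.leviCivita (fun y ↦ g.leviCivita K y (Y y)) x (X x)
      - g.leviCivita K x (g.leviCivita Y x (X x))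
  have symm : ∀ {X Y : Π x : M, TangentSpace I x}, CMDiffAt ∞ (T% X) x → CMDiffAt ∞ (T% Y) x →
      D X Y = D Y X := by
    intro X Y hX hY
    have h1 := hx X Y K hX hY (K.contMDiff x)
    have h2 := g.leviCivita_torsion (hX.mdifferentiableAt (by simp))
      (hY.mdifferentiableAt (by simp))
    rw [curvature, ← h2, map_sub] at h1
    simp only [D]
    rw [← sub_eq_zero, ← h1]
    abel
  suffices h : D X Y = 0 from sub_eq_zero.1 h
  apply g.eq_of_form_eq
  intro w
  set Z := FiberBundle.extend E w
  have hZ : CMDiffAt ∞ (T% Z) x := FiberBundle.contMDiffAt_extend ..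
  have hw : w = Z x := by simp [Z]
  have skew : ∀ {X Y Z : Π x : M, TangentSpace I x}, CMDiffAt ∞ (T% X) x →
      CMDiffAt ∞ (T% Y) x → CMDiffAt ∞ (T% Z) x →
      g.form x (D X Y) (Z x) = -g.form x (D X Z) (Y x) :=
    fun hX hY hZ ↦ hK.form_second_deriv_skew hX hY hZ
  have h1 := skew hX hY hZ
  rw [symm hX hZ, skew hZ hX hY, symm hZ hY, skew hY hZ hX, symm hY hX] at h1
  rw [hw, map_zero, zero_apply]
  linarith

/-- Where the curvature vanishes, the covariant derivative of the bracket of two Killing fields is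
the opposite of the commutator of their covariant derivatives. -/
theorem IsKilling.leviCivita_bracket (hK : g.IsKilling K) (hL : g.IsKilling L)
    (hx : g.CurvatureVanishesAt x) (u : TangentSpace I x) :
    g.leviCivita (⁅K, L⁆ : SmoothVectorField I M) x u =
      g.leviCivita L x (g.leviCivita K x u) - g.leviCivita K x (g.leviCivita L x u) := by
  have hs : (fun y ↦ g.leviCivita L y (K y)) =
      ((⁅K, L⁆ : SmoothVectorField I M) : Π y, TangentSpace I y)
        + fun y ↦ g.leviCivita K y (L y) := by
    funext y
    have h := g.leviCivita_torsion (K.mdifferentiableAt y) (L.mdifferentiableAt y)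
    exact (sub_eq_iff_eq_add.1 h)
  have hLK := g.contMDiffAt_leviCivita (L.contMDiff x) (K.contMDiff x)
  have h1 := g.leviCivita.isCovariantDerivativeOnUniv.add (⁅K, L⁆.mdifferentiableAt x)
    (hLK.mdifferentiableAt (by simp)) (Set.mem_univ x)
  rw [← hs] at h1
  set U := FiberBundle.extend E u
  have hU : CMDiffAt ∞ (T% U) x := FiberBundle.contMDiffAt_extend ..
  have hu : u = U x := by simp [U]
  have h2 := congrArg (fun φ : TangentSpace I x →L[ℝ] TangentSpace I x ↦ φ u) h1
  have h3 := hL.second_deriv_eq_zero hx hU (K.contMDiff x)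
  have h4 := hK.second_deriv_eq_zero hx hU (L.contMDiff x)
  rw [← hu] at h3 h4
  rw [eq_sub_iff_add_eq, ← h3, ← h4]
  exact h2.symm

end PseudoRiemannianMetric

/-! ### Unique continuation of Killing fields -/

section Chart

set_option maxSynthPendingDepth 3

variable {E : Type*} [NormedAddCommGroup E] [NormedSpace ℝ E]
  {H : Type*} [TopologicalSpace H] {I : ModelWithCorners ℝ E H}
  {M : Type*} [TopologicalSpace M] [ChartedSpace H M]

/-- The representation of a vector field in the preferred chart at `x`, a vector field on the
model vector space, to be considered on the target of the chart. -/
def chartRep (x : M) (V : Π m : M, TangentSpace I m) : E → E :=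
  mpullback 𝓘(ℝ, E) I (extChartAt I x).symm V

theorem chartRep_eq_zero {V : Π m : M, TangentSpace I m} {x : M} {y : E}
    (h : V ((extChartAt I x).symm y) = 0) : chartRep x V y = 0 := by
  rw [chartRep, mpullback_apply, h, map_zero]
  rfl

theorem chartRep_eventually_eq_zero {V : Π m : M, TangentSpace I m} {x z : M}
    (hz : z ∈ (extChartAt I x).source) (h : ∀ᶠ m in nhds z, V m = 0) :
    ∀ᶠ y in nhds (extChartAt I x z), chartRep x V y = 0 := by
  have hc := (continuousAt_extChartAt_symm' hz).tendsto
  rw [(extChartAt I x).left_inv hz] at hc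
  filter_upwards [hc.eventually h] with y hy using chartRep_eq_zero hy

variable [IsManifold I ∞ M]

theorem mem_baseSet_of_mem_target {x : M} {y : E} (hy : y ∈ (extChartAt I x).target) :
    (extChartAt I x).symm y ∈ (trivializationAt E (TangentSpace I : M → Type _) x).baseSet := by
  rw [TangentBundle.trivializationAt_baseSet, ← extChartAt_source I]
  exact (extChartAt I x).map_target hy

variable [I.Boundaryless]

theorem contMDiffAt_extChartAt_symm {x : M} {y : E} (hy : y ∈ (extChartAt I x).target) :
    CMDiffAt ∞ (extChartAt I x).symm y :=
  (contMDiffOn_extChartAt_symm x).contMDiffAt ((isOpen_extChartAt_target x).mem_nhds hy)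

theorem mfderiv_extChartAt_symm {x : M} {y : E} (hy : y ∈ (extChartAt I x).target) :
    mfderiv% (extChartAt I x).symm y =
      (trivializationAt E (TangentSpace I) x).symmL ℝ ((extChartAt I x).symm y) := by
  rw [TangentBundle.symmL_trivializationAt, (extChartAt I x).right_inv hy, I.range_eq_univ,
    mfderivWithin_univ]
  rw [← extChartAt_source I]
  exact (extChartAt I x).map_target hy

theorem isInvertible_mfderiv_extChartAt_symm {x : M} {y : E} (hy : y ∈ (extChartAt I x).target) :
    (mfderiv% (extChartAt I x).symm y).IsInvertible := by
  have h := isInvertible_mfderivWithin_extChartAt_symm hy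
  rwa [I.range_eq_univ, mfderivWithin_univ] at h

theorem symmL_chartRep (V : Π m : M, TangentSpace I m) {x : M} {y : E}
    (hy : y ∈ (extChartAt I x).target) :
    (trivializationAt E (TangentSpace I) x).symmL ℝ ((extChartAt I x).symm y) (chartRep x V y) =
      V ((extChartAt I x).symm y) := by
  rw [← mfderiv_extChartAt_symm hy]
  exact (isInvertible_mfderiv_extChartAt_symm hy).self_apply_inverse _

theorem chartRep_coordField {x : M} {y : E} (hy : y ∈ (extChartAt I x).target) (u : E) :
    chartRep x (coordField I x u) y = u := by
  have h := mem_baseSet_of_mem_target hy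
  have h1 := congrArg ((trivializationAt E (TangentSpace I) x).continuousLinearMapAt ℝ _)
    (symmL_chartRep (coordField I x u) hy)
  rwa [Trivialization.continuousLinearMapAt_symmL _ h, coordField,
    Trivialization.continuousLinearMapAt_symmL _ h] at h1

theorem contDiffAt_chartRep [FiniteDimensional ℝ E] {V : Π m : M, TangentSpace I m} {x : M} {y : E}
    (hy : y ∈ (extChartAt I x).target) (hV : CMDiffAt ∞ (T% V) ((extChartAt I x).symm y)) :
    ContDiffAt ℝ ∞ (chartRep x V) y := by
  have := FiniteDimensional.complete ℝ E
  exact contMDiffAt_vectorSpace_iff_contDiffAt.1 (ContMDiffAt.mpullback_vectorField_preimage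
    (n := ∞) hV (contMDiffAt_extChartAt_symm hy) (isInvertible_mfderiv_extChartAt_symm hy)
    (by simp))

theorem mlieBracket_const_right (W : Π y : E, TangentSpace 𝓘(ℝ, E) y) (u y : E) :
    mlieBracket 𝓘(ℝ, E) W (fun _ ↦ u) y = -fderiv ℝ (W : E → E) y u := by
  have h1 : ∀ V : E → E, lieBracketWithin ℝ V (fun _ ↦ u) Set.univ y = -fderiv ℝ V y u := by
    intro V
    rw [lieBracketWithin_univ, lieBracket_eq]
    simp
  exact (congrFun mlieBracketWithin_univ y).symm.trans
    ((congrFun mlieBracketWithin_eq_lieBracketWithin y).trans (h1 W))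

/-- The bracket of a vector field with a coordinate field is, up to sign, its derivative in the
chart. -/
theorem mlieBracket_coordField [FiniteDimensional ℝ E] {V : Π m : M, TangentSpace I m} {x : M}
    {y : E} (hy : y ∈ (extChartAt I x).target)
    (hV : MDiffAt (T% V) ((extChartAt I x).symm y)) (u : E) :
    mlieBracket I V (coordField I x u) ((extChartAt I x).symm y) =
      -(trivializationAt E (TangentSpace I) x).symmL ℝ ((extChartAt I x).symm y)
        (fderiv ℝ (chartRep x V) y u) := by
  have := FiniteDimensional.complete ℝ E
  have : IsManifold I (minSmoothness ℝ 2) M := by simpa using inferInstanceAs (IsManifold I 2 M)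
  have hu : MDiffAt (T% (coordField I x u)) ((extChartAt I x).symm y) :=
    (contMDiffAt_coordField (mem_baseSet_of_mem_target hy) u).mdifferentiableAt (by simp)
  have h := mpullback_mlieBracket (I := 𝓘(ℝ, E)) hV hu (contMDiffAt_extChartAt_symm hy)
    (by simpa using two_le_infty)
  have hc : chartRep x (coordField I x u) =ᶠ[nhds y] fun _ ↦ u := by
    filter_upwards [(isOpen_extChartAt_target x).mem_nhds hy] with z hz
      using chartRep_coordField hz u
  have h2 := (Filter.EventuallyEq.mlieBracket_vectorField_eq (I := 𝓘(ℝ, E))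
    (Filter.EventuallyEq.refl _ (chartRep x V)) hc).trans (mlieBracket_const_right _ u y)
  rw [← symmL_chartRep (mlieBracket I V (coordField I x u)) hy, ← map_neg]
  exact congrArg _ (h.trans h2)

/-- The derivative of a function on the manifold in terms of its expression in a chart. -/
theorem fderiv_comp_extChartAt_symm {f : M → ℝ} {x : M} {y : E}
    (hy : y ∈ (extChartAt I x).target) (hf : MDiffAt f ((extChartAt I x).symm y)) (u : E) :
    fderiv ℝ (fun z ↦ f ((extChartAt I x).symm z)) y u = d% f ((extChartAt I x).symm y)
      ((trivializationAt E (TangentSpace I) x).symmL ℝ ((extChartAt I x).symm y) u) := by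
  have h := mvfderiv_comp (I' := 𝓘(ℝ, E)) y hf
    ((contMDiffAt_extChartAt_symm hy).mdifferentiableAt (by simp))
  rw [mfderiv_extChartAt_symm hy] at h
  have h2 := congrArg (fun φ : E →L[ℝ] ℝ ↦ φ u) h
  rw [mvfderiv, mfderiv_eq_fderiv] at h2
  exact h2

theorem eventually_eq_zero_of_chartRep {V : Π m : M, TangentSpace I m} {x : M}
    (h : ∀ᶠ y in nhds (extChartAt I x x), chartRep x V y = 0) : ∀ᶠ m in nhds x, V m = 0 := by
  filter_upwards [(continuousAt_extChartAt x).tendsto.eventually h,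
    extChartAt_source_mem_nhds (I := I) x] with m hm hs
  have h1 := symmL_chartRep V ((extChartAt I x).map_source hs)
  rw [hm, map_zero, (extChartAt I x).left_inv hs] at h1
  exact h1.symm

end Chart

namespace PseudoRiemannianMetric

set_option maxSynthPendingDepth 3

variable {E : Type*} [NormedAddCommGroup E] [NormedSpace ℝ E] [FiniteDimensional ℝ E]
  {H : Type*} [TopologicalSpace H] {I : ModelWithCorners ℝ E H} [I.Boundaryless]
  {M : Type*} [TopologicalSpace M] [ChartedSpace H M] [IsManifold I ∞ M]
  {p q : ℕ} {g : PseudoRiemannianMetric I M p q} {K : SmoothVectorField I M} {x : M}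

theorem contDiffAt_gram_extChartAt_symm (g : PseudoRiemannianMetric I M p q) {y : E}
    (hy : y ∈ (extChartAt I x).target) :
    ContDiffAt ℝ ∞ (fun y ↦ g.gram x ((extChartAt I x).symm y)) y :=
  ((g.contMDiffAt_gram (mem_baseSet_of_mem_target hy)).comp y
    (contMDiffAt_extChartAt_symm hy)).contDiffAt

/-- Killing's equation in a chart. -/
theorem IsKilling.chart_eq (hK : g.IsKilling K) {y : E} (hy : y ∈ (extChartAt I x).target)
    (u v : E) :
    fderiv ℝ (fun y ↦ g.gram x ((extChartAt I x).symm y)) y (chartRep x K y) u v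
      + g.gram x ((extChartAt I x).symm y) (fderiv ℝ (chartRep x K) y u) v
      + g.gram x ((extChartAt I x).symm y) (fderiv ℝ (chartRep x K) y v) u = 0 := by
  set m := (extChartAt I x).symm y
  set e := trivializationAt E (TangentSpace I : M → Type _) x
  have hG := (g.contDiffAt_gram_extChartAt_symm hy).differentiableAt (by simp)
  have hc : ∀ u, MDiffAt (T% (coordField I x u)) m := fun u ↦
    (contMDiffAt_coordField (mem_baseSet_of_mem_target hy) u).mdifferentiableAt (by simp)
  have hKm := K.mdifferentiableAt m
  have h1 := g.lieDerivative_form hKm (hc u) (hc v)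
  rw [hK, add_zero, mlieBracket_coordField hy hKm u, mlieBracket_coordField hy hKm v] at h1
  have h2 := fderiv_comp_extChartAt_symm hy (g.mdifferentiableAt_pair (hc u) (hc v))
    (chartRep x K y)
  rw [symmL_chartRep K hy] at h2
  have h3 : fderiv ℝ (fun z ↦ g.pair (coordField I x u) (coordField I x v)
      ((extChartAt I x).symm z)) y (chartRep x K y) =
      fderiv ℝ (fun y ↦ g.gram x ((extChartAt I x).symm y)) y (chartRep x K y) u v := by
    have h4 := (hG.hasFDerivAt.clm_apply (hasFDerivAt_const u y)).clm_apply (hasFDerivAt_const v y)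
    have h5 := congrArg (fun φ : E →L[ℝ] ℝ ↦ φ (chartRep x K y)) h4.fderiv
    simp at h5
    exact h5
  rw [← h3, h2, h1]
  change g.form m (-e.symmL ℝ m (fderiv ℝ (chartRep x K) y u)) (e.symmL ℝ m v)
    + g.form m (e.symmL ℝ m u) (-e.symmL ℝ m (fderiv ℝ (chartRep x K) y v))
    + g.form m (e.symmL ℝ m (fderiv ℝ (chartRep x K) y u)) (e.symmL ℝ m v)
    + g.form m (e.symmL ℝ m (fderiv ℝ (chartRep x K) y v)) (e.symmL ℝ m u) = 0
  rw [g.symm m (e.symmL ℝ m u)]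
  simp only [map_neg, neg_apply]
  ring

/-- A Killing field that vanishes to first order at a point vanishes near that point. -/
theorem IsKilling.eventually_eq_zero (hK : g.IsKilling K)
    (h0 : chartRep x K (extChartAt I x x) = 0)
    (h1 : fderiv ℝ (chartRep x K) (extChartAt I x x) = 0) : ∀ᶠ m in nhds x, K m = 0 := by
  apply eventually_eq_zero_of_chartRep (x := x)
  have hx := mem_extChartAt_target (I := I) x
  refine eventually_eq_zero_of_killing_eq
    ((g.contDiffAt_gram_extChartAt_symm hx).of_le two_le_infty)
    ((contDiffAt_chartRep hx (K.contMDiff _)).of_le two_le_infty)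
    (g.gram_injective (mem_baseSet_of_mem_target hx)) ?_ h0 h1
  filter_upwards [(isOpen_extChartAt_target x).mem_nhds hx] with y hy using hK.chart_eq hy

/-- A Killing field on a connected manifold is determined by its value and its covariant
derivative at one point. -/
theorem IsKilling.eq_zero [ConnectedSpace M] (hK : g.IsKilling K) (h0 : K x = 0)
    (h1 : g.leviCivita K x = 0) : K = 0 := by
  -- the interior of the zero set, which is also closed
  let Z : Set M := {z | ∀ᶠ m in nhds z, K m = 0}
  have hopen : IsOpen Z := isOpen_iff_mem_nhds.2 fun z hz ↦ eventually_eventually_nhds.2 hz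
  have hclosed : IsClosed Z := by
    refine isClosed_of_closure_subset fun z hz ↦ ?_
    have hk := contDiffAt_chartRep (mem_extChartAt_target (I := I) z) (K.contMDiff _)
    have hfreq := mem_closure_iff_frequently.1 hz
    -- a continuous function in the chart that vanishes at the points of `Z` vanishes at `z`
    have limit : ∀ {F : Type _} [NormedAddCommGroup F] {f : E → F},
        ContinuousAt f (extChartAt I z z) →
        (∀ z' ∈ Z, z' ∈ (extChartAt I z).source → f (extChartAt I z z') = 0) →
        f (extChartAt I z z) = 0 := by
      intro F _ f hf hf0
      by_contra hne
      have h2 : ∀ᶠ m in nhds z, f (extChartAt I z m) ≠ 0 :=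
        (ContinuousAt.comp (g := f) hf (continuousAt_extChartAt z)).eventually_ne hne
      obtain ⟨m, hm, hm', hs⟩ := (hfreq.and_eventually
        (h2.and (extChartAt_source_mem_nhds (I := I) z))).exists
      exact hm' (hf0 m hm hs)
    refine hK.eventually_eq_zero (limit hk.continuousAt fun z' hz' hs ↦
        (chartRep_eventually_eq_zero hs hz').self_of_nhds)
      (limit (hk.fderiv_right (m := 0) (by simp)).continuousAt fun z' hz' hs ↦ ?_)
    have h2 : chartRep z K =ᶠ[nhds (extChartAt I z z')] fun _ ↦ 0 :=
      chartRep_eventually_eq_zero hs hz'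
    rw [h2.fderiv_eq]
    simp
  have hx : x ∈ Z := by
    have hxt := mem_extChartAt_target (I := I) x
    have e0 : chartRep x K (extChartAt I x x) = 0 := by
      apply chartRep_eq_zero
      rwa [extChartAt_to_inv]
    refine hK.eventually_eq_zero e0 ?_
    -- as `K` and `∇K` vanish at `x`, so do the brackets of `K` with the coordinate fields
    ext u
    have hb : x ∈ (trivializationAt E (TangentSpace I : M → Type _) x).baseSet :=
      FiberBundle.mem_baseSet_trivializationAt' x
    have hX : CMDiffAt ∞ (T% (coordField I x u)) x := contMDiffAt_coordField hb u
    have hX' := hX.mdifferentiableAt (by simp)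
    have h2 := g.leviCivita_torsion (K.mdifferentiableAt x) hX'
    rw [h0, h1, map_zero, zero_apply, sub_zero] at h2
    have h3 := mlieBracket_coordField hxt (K.mdifferentiableAt _) u
    rw [extChartAt_to_inv, ← h2, zero_eq_neg] at h3
    have h5 := congrArg ((trivializationAt E (TangentSpace I) x).continuousLinearMapAt ℝ x) h3
    rwa [Trivialization.continuousLinearMapAt_symmL _ hb, map_zero] at h5
  have huniv := IsClopen.eq_univ ⟨hclosed, hopen⟩ ⟨x, hx⟩
  ext m
  have hm : m ∈ Z := huniv ▸ Set.mem_univ m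
  exact hm.self_of_nhds

end PseudoRiemannianMetric

/-! ### The homomorphism to the Euclidean Lie algebra -/

namespace PseudoRiemannianMetric

variable {E : Type*} [NormedAddCommGroup E] [NormedSpace ℝ E] [FiniteDimensional ℝ E]
  {H : Type*} [TopologicalSpace H] {I : ModelWithCorners ℝ E H}
  {M : Type*} [TopologicalSpace M] [ChartedSpace H M] [IsManifold I ∞ M]
  {p q : ℕ} (g : PseudoRiemannianMetric I M p q)

/-- The covariant derivative of a vector field at a point, as a matrix with respect to a basis of
the tangent space. -/
def derivMatrix {x : M} (b : Module.Basis (Fin p ⊕ Fin q) ℝ (TangentSpace I x))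
    (K : Π x : M, TangentSpace I x) : Matrix (Fin p ⊕ Fin q) (Fin p ⊕ Fin q) ℝ :=
  LinearMap.toMatrix b b (g.leviCivita K x : TangentSpace I x →ₗ[ℝ] TangentSpace I x)

variable {g}

theorem derivMatrix_mulVec_repr {x : M}
    (b : Module.Basis (Fin p ⊕ Fin q) ℝ (TangentSpace I x)) (K : Π x : M, TangentSpace I x)
    (u : TangentSpace I x) :
    (g.derivMatrix b K).mulVec (b.repr u) = b.repr (g.leviCivita K x u) :=
  LinearMap.toMatrix_mulVec_repr b b _ u

/-- Killing's equation says that `∇K` is skew-symmetric. -/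
theorem IsKilling.derivMatrix_mem_so {x : M}
    {b : Module.Basis (Fin p ⊕ Fin q) ℝ (TangentSpace I x)}
    (hb : ∀ i j, g.form x (b i) (b j) =
      LieAlgebra.Orthogonal.indefiniteDiagonal (Fin p) (Fin q) ℝ i j)
    {K : Π x : M, TangentSpace I x} (hK : g.IsKilling K) :
    g.derivMatrix b K ∈ LieAlgebra.Orthogonal.so' (Fin p) (Fin q) ℝ := by
  rw [LieAlgebra.Orthogonal.so', mem_skewAdjointMatricesLieSubalgebra]
  refine (mem_skewAdjointMatricesSubmodule _ _).2 ?_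
  set A := g.leviCivita K x
  have key : ∀ i u, g.form x (b i) u =
      ∑ k, LieAlgebra.Orthogonal.indefiniteDiagonal (Fin p) (Fin q) ℝ i k * b.repr u k := by
    intro i u
    conv_lhs => rw [← b.sum_repr u]
    simp only [map_sum, map_smul, smul_eq_mul, hb, mul_comm]
  have hN : ∀ i j, g.derivMatrix b K i j = b.repr (A (b j)) i := fun i j ↦
    LinearMap.toMatrix_apply ..
  ext i j
  have h1 := hK x (b i) (b j)
  rw [g.symm x _ (b j), g.symm x _ (b i), key, key] at h1
  -- the indefinite diagonal matrix is symmetric, being a Gram matrix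
  have hJ : ∀ k, LieAlgebra.Orthogonal.indefiniteDiagonal (Fin p) (Fin q) ℝ k j =
      LieAlgebra.Orthogonal.indefiniteDiagonal (Fin p) (Fin q) ℝ j k := fun k ↦ by
    rw [← hb, ← hb, g.symm]
  simp only [Matrix.mul_apply, Matrix.transpose_apply, Matrix.neg_apply, hN, hJ, mul_neg,
    Finset.sum_neg_distrib]
  rw [eq_neg_iff_add_eq_zero, ← h1]
  congr 1
  exact Finset.sum_congr rfl fun k _ ↦ mul_comm _ _

variable (g)

/-- The homomorphism `K ↦ (K(x), -∇K(x))` from Killing fields to `ℝⁿ ⋊ so(p, q)`, for a point `x`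
where the curvature vanishes and an orthonormal basis of the tangent space at `x`. -/
def killingHom {x : M} (hx : g.CurvatureVanishesAt x)
    (b : Module.Basis (Fin p ⊕ Fin q) ℝ (TangentSpace I x))
    (hb : ∀ i j, g.form x (b i) (b j) =
      LieAlgebra.Orthogonal.indefiniteDiagonal (Fin p) (Fin q) ℝ i j) :
    g.killingAlgebra →ₗ⁅ℝ⁆ EuclideanLieAlgebra p q where
  toFun K := ⟨(b.equivFun (K.1 x) : Fin p ⊕ Fin q → ℝ),
    ⟨-g.derivMatrix b K.1, neg_mem (IsKilling.derivMatrix_mem_so hb K.2)⟩⟩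
  map_add' K L := by
    have h := g.leviCivita.isCovariantDerivativeOnUniv.add (K.1.mdifferentiableAt x)
      (L.1.mdifferentiableAt x) (Set.mem_univ x)
    refine LieAlgebra.SemiDirectSum.ext (map_add b.equivFun (K.1 x) (L.1 x)) (Subtype.ext ?_)
    change -LinearMap.toMatrix b b (g.leviCivita.toFun (K.1 + L.1) x :
      TangentSpace I x →ₗ[ℝ] TangentSpace I x) = -g.derivMatrix b K.1 + -g.derivMatrix b L.1
    rw [h, ContinuousLinearMap.toLinearMap_add, map_add, neg_add]
    rfl
  map_smul' c K := by
    have h := g.leviCivita.isCovariantDerivativeOnUniv.smul_const c (K.1.mdifferentiableAt x)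
      (Set.mem_univ x)
    refine LieAlgebra.SemiDirectSum.ext (map_smul b.equivFun c (K.1 x)) (Subtype.ext ?_)
    change -LinearMap.toMatrix b b (g.leviCivita.toFun (c • K.1) x :
      TangentSpace I x →ₗ[ℝ] TangentSpace I x) = c • -g.derivMatrix b K.1
    rw [h, ContinuousLinearMap.toLinearMap_smul, map_smul, smul_neg]
    rfl
  map_lie' {K L} := by
    refine LieAlgebra.SemiDirectSum.ext ?_ (Subtype.ext ?_)
    · have h := g.leviCivita_torsion (K.1.mdifferentiableAt x) (L.1.mdifferentiableAt x)
      change (b.repr (mlieBracket I K.1 L.1 x) : Fin p ⊕ Fin q → ℝ) =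
        0 + (-g.derivMatrix b K.1).mulVec (b.repr (L.1 x))
          - (-g.derivMatrix b L.1).mulVec (b.repr (K.1 x))
      rw [Matrix.neg_mulVec, Matrix.neg_mulVec, derivMatrix_mulVec_repr, derivMatrix_mulVec_repr,
        ← h, map_sub, Finsupp.coe_sub]
      abel
    · change -g.derivMatrix b (⁅K.1, L.1⁆ : SmoothVectorField I M) =
        -g.derivMatrix b K.1 * -g.derivMatrix b L.1 - -g.derivMatrix b L.1 * -g.derivMatrix b K.1
      have h : (g.leviCivita (⁅K.1, L.1⁆ : SmoothVectorField I M) x :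
          TangentSpace I x →ₗ[ℝ] TangentSpace I x) =
          (g.leviCivita L.1 x : TangentSpace I x →ₗ[ℝ] TangentSpace I x) ∘ₗ g.leviCivita K.1 x
          - (g.leviCivita K.1 x : TangentSpace I x →ₗ[ℝ] TangentSpace I x) ∘ₗ
            g.leviCivita L.1 x :=
        LinearMap.ext fun u ↦ IsKilling.leviCivita_bracket K.2 L.2 hx u
      rw [derivMatrix, h, map_sub, LinearMap.toMatrix_comp b b b, LinearMap.toMatrix_comp b b b,
        neg_mul_neg, neg_mul_neg, neg_sub]
      rfl

theorem killingHom_injective [I.Boundaryless] [ConnectedSpace M] {x : M}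
    (hx : g.CurvatureVanishesAt x)
    (b : Module.Basis (Fin p ⊕ Fin q) ℝ (TangentSpace I x))
    (hb : ∀ i j, g.form x (b i) (b j) =
      LieAlgebra.Orthogonal.indefiniteDiagonal (Fin p) (Fin q) ℝ i j) :
    Function.Injective (g.killingHom hx b hb) := by
  refine (injective_iff_map_eq_zero _).2 fun K hK ↦
    Subtype.ext (IsKilling.eq_zero (x := x) K.2 ?_ ?_)
  · exact b.equivFun.map_eq_zero_iff.1 (congrArg LieAlgebra.SemiDirectSum.left hK)
  · have h : -g.derivMatrix b K.1 = 0 :=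
      congrArg Subtype.val (congrArg LieAlgebra.SemiDirectSum.right hK)
    exact ContinuousLinearMap.coe_injective
      ((LinearMap.toMatrix b b).map_eq_zero_iff.1 (neg_eq_zero.1 h))

end PseudoRiemannianMetric

end

theorem mainTheorem4 {p q : ℕ} {M : Type*} [TopologicalSpace M] [T2Space M] [ConnectedSpace M]
    [ChartedSpace (EuclideanSpace ℝ (Fin (p + q))) M] [IsManifold (𝓡 (p + q)) ∞ M]
    (g : PseudoRiemannianMetric (𝓡 (p + q)) M p q) (hx : ∃ x : M, g.CurvatureVanishesAt x) :
    ∃ S : LieSubalgebra ℝ (EuclideanLieAlgebra p q), Nonempty (g.killingAlgebra ≃ₗ⁅ℝ⁆ S) := by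
  obtain ⟨x, hx⟩ := hx
  obtain ⟨b, hb⟩ := g.signature x
  exact ⟨_, ⟨LieEquiv.ofInjective (g.killingHom hx b hb) (g.killingHom_injective hx b hb)⟩⟩
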